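/- **Theorem 1 (Distributionally Robust Soft Policy Iteration).** Let $\mathcal S$ be a measurable space of states and $\mathcal A$ a finite nonempty set of actions. Let $R$ be a random reward such that $R(s,a)$ is supported on $[0,R_{\max}]$, let $p^0_{s,a}$ be nominal transition distributions on $\mathcal S$ (both being probability kernels in $(s,a)$), and let $\gamma\in[0,1)$, $\delta>0$ and $\alpha>0$. Put $\mathcal P_{s,a}(\delta)=\{p : D_{\mathrm{KL}}(p\,\|\,p^0_{s,a})\le\delta\}$, and let $\mathcal P(\delta)$ be the set of all transition kernels $\mathbf p$ with $\mathbf p_{s,a}\in\mathcal P_{s,a}(\delta)$ for all $(s,a)$. Let $\Pi$ be the set of stationary stochastic policies (probability kernels $\pi(\cdot\mid s)$ from $\mathcal S$ to $\mathcal A$), let $\mathcal H(\pi(s))=\mathbb E_{a\sim\pi(\cdot\mid s)}[-\log\pi(a\mid s)]$, and define, for $\pi\in\Pi$, $$V^\pi(s)=\inf_{\mathbf p\in\mathcal P(\delta)}\mathbb E_{\mathbf p}\Big[\sum_{t\ge1}\gamma^{t-1}\big(r_t+\alpha\mathcal H(\pi(s_t))\big)\,\Big|\,\pi,s_1=s\Big],$$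 $$Q^\pi(s,a)=\inf_{\mathbf p\in\mathcal P(\delta)}\mathbb E_{\mathbf p}\Big[r_1+\sum_{t\ge2}\gamma^{t-1}\big(r_t+\alpha\mathcal H(\pi(s_t))\big)\,\Big|\,\pi,s_1=s,a_1=a\Big],$$ and, for bounded measurable $Q:\mathcal S\times\mathcal A\to\mathbb R$, $$\mathcal T^\pi_\delta Q(s,a)=\mathbb E[R(s,a)]+\gamma\inf_{p\in\mathcal P_{s,a}(\delta)}\mathbb E_{s'\sim p,\,a'\sim\pi(\cdot\mid s')}\big[Q(s',a')-\alpha\log\pi(a'\mid s')\big].$$ A policy is *optimal* if it maximizes $V^\pi(s)$ over $\pi\in\Pi$ for every $s\in\mathcal S$ simultaneously. There is exactly one optimal policy $\pi^\star$. Starting from any policy $\pi_0\in\Pi$, alternate, for $k=0,1,2,\dots$, 1. (policy evaluation) $Q_k=\lim_{n\to\infty}(\mathcal T^{\pi_k}_\delta)^n Q_k^{(0)}$ pointwise, where $Q_k^{(0)}$ is any bounded measurable function on $\mathcal S\times\mathcal A$; 2. (policy improvement) for every $s\in\mathcal S$, $\pi_{k+1}$ minimizes $D_{\mathrm{KL}}\big(\pi(\cdot\mid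 s)\,\big\|\,\exp(Q_k(s,\cdot)/\alpha)/Z_k(s)\big)$ over $\pi\in\Pi$, where $Z_k(s)=\sum_{a\in\mathcal A}\exp(Q_k(s,a)/\alpha)$. Such sequences exist, and every such sequence satisfies $Q_k=Q^{\pi_k}$ for all $k$ and converges to the optimal policy: $\sup_{s\in\mathcal S,\,a\in\mathcal A}|\pi_k(a\mid s)-\pi^\star(a\mid s)|\to0$ as $k\to\infty$. -/

import Mathlib

open MeasureTheory ProbabilityTheory Filter Topology

noncomputable section

namespace DRSoft

variable {S A : Type*} [MeasurableSpace S] [MeasurableSpace A]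

/-- Stochastic stationary policies: Markov kernels from states to actions. -/
def Policy (S A : Type*) [MeasurableSpace S] [MeasurableSpace A] : Type _ :=
  {π : Kernel S A // IsMarkovKernel π}

/-- Transition models: Markov kernels from state-action pairs to states. -/
def TransitionModel (S A : Type*) [MeasurableSpace S] [MeasurableSpace A] : Type _ :=
  {p : Kernel (S × A) S // IsMarkovKernel p}

instance (π : Policy S A) : IsMarkovKernel π.1 := π.2

instance (p : TransitionModel S A) : IsMarkovKernel p.1 := p.2

/-- The probability `π(a | s)`. -/
def Policy.prob (π : Policy S A) (s : S) (a : A) : ℝ := (π.1 s).real {a}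

/-- The entropy `E_{a ∼ π(s)} [- log π(a | s)]`. -/
def Policy.entropy (π : Policy S A) (s : S) : ℝ := ∫ a, -Real.log (π.prob s a) ∂(π.1 s)

/-- The data of a robust Markov decision process with an entropy bonus: a nominal transition model,
random rewards supported on `[0, Rmax]`, the discount factor `γ`, the radius `δ` of the
Kullback-Leibler balls and the temperature `α`. -/
structure RobustMDP (S A : Type*) [MeasurableSpace S] [MeasurableSpace A] where
  nominal : TransitionModel S A
  reward : Kernel (S × A) ℝ
  reward_markov : IsMarkovKernel reward
  Rmax : ℝ
  reward_mem : ∀ x, ∀ᵐ r ∂(reward x), r ∈ Set.Icc 0 Rmax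
  γ : ℝ
  γ_nonneg : 0 ≤ γ
  γ_lt_one : γ < 1
  δ : ℝ
  δ_pos : 0 < δ
  α : ℝ
  α_pos : 0 < α

namespace RobustMDP

variable (M : RobustMDP S A)

instance : IsMarkovKernel M.reward := M.reward_markov

/-- The Kullback-Leibler ball around the nominal distribution of the next state. -/
def klBall (x : S × A) : Set (ProbabilityMeasure S) :=
  {p | InformationTheory.klDiv (p : Measure S) (M.nominal.1 x) ≤ ENNReal.ofReal M.δ}

/-- The `(s, a)`-rectangular ambiguity set: the transition models all of whose distributions lie in
the respective Kullback-Leibler balls. -/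
def ambiguitySet : Set (TransitionModel S A) :=
  {p | ∀ x, InformationTheory.klDiv (p.1 x) (M.nominal.1 x) ≤ ENNReal.ofReal M.δ}

/-- `s ↦` the law of `(s, a)` with `a ∼ π(s)`. -/
def drawAction (π : Policy S A) : Kernel S (S × A) := Kernel.id ×ₖ π.1

instance (π : Policy S A) : IsMarkovKernel (drawAction π) := by
  unfold drawAction; infer_instance

/-- `(s, a) ↦` the law of `((s, a), r)` with `r ∼ R(s, a)`. -/
def drawReward : Kernel (S × A) ((S × A) × ℝ) := Kernel.id ×ₖ M.reward

instance : IsMarkovKernel M.drawReward := by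
  unfold drawReward; infer_instance

/-- One step of the process `((s_t, a_t), r_t)` under the model `p` and the policy `π`. -/
def step (p : TransitionModel S A) (π : Policy S A) : Kernel ((S × A) × ℝ) ((S × A) × ℝ) :=
  (M.drawReward ∘ₖ (drawAction π ∘ₖ p.1)).comap Prod.fst measurable_fst

instance (p : TransitionModel S A) (π : Policy S A) : IsMarkovKernel (M.step p π) := by
  unfold step; infer_instance

/-- The law of the process `((s_t, a_t), r_t)`, `t = 0, 1, …`, under the model `p` and the policy
`π`, when the first triple has the law `init`. -/
def processLaw (p : TransitionModel S A) (π : Policy S A) (init : Measure ((S × A) × ℝ))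
    [IsProbabilityMeasure init] : Measure (ℕ → (S × A) × ℝ) :=
  Kernel.trajMeasure (X := fun _ => (S × A) × ℝ) init
    (fun n => (M.step p π).comap (fun h => h ⟨n, by simp⟩) (measurable_pi_apply _))

/-- The soft value function of `π` under the model `p` (time is counted from `0`). -/
def modelV (p : TransitionModel S A) (π : Policy S A) (s : S) : ℝ :=
  ∫ ω, ∑' t : ℕ, M.γ ^ t * ((ω t).2 + M.α * π.entropy (ω t).1.1)
    ∂(M.processLaw p π ((M.drawReward ∘ₖ drawAction π) s))

/-- The soft Q-function of `π` under the model `p` (time is counted from `0`). -/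
def modelQ (p : TransitionModel S A) (π : Policy S A) (x : S × A) : ℝ :=
  ∫ ω, (ω 0).2 + ∑' t : ℕ, M.γ ^ (t + 1) * ((ω (t + 1)).2 + M.α * π.entropy (ω (t + 1)).1.1)
    ∂(M.processLaw p π (M.drawReward x))

/-- The distributionally robust soft value function. -/
def robustV (π : Policy S A) (s : S) : ℝ := ⨅ p : M.ambiguitySet, M.modelV p.1 π s

/-- The distributionally robust soft Q-function. -/
def robustQ (π : Policy S A) (x : S × A) : ℝ := ⨅ p : M.ambiguitySet, M.modelQ p.1 π x

/-- `π` is a distributionally robust optimal policy: it maximizes the robust value at every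
state. -/
def IsOptimal (π : Policy S A) : Prop := ∀ (π' : Policy S A) (s : S), M.robustV π' s ≤ M.robustV π s

/-- The distributionally robust soft Bellman operator. -/
def bellman (π : Policy S A) (Q : S × A → ℝ) (x : S × A) : ℝ :=
  (∫ r, r ∂(M.reward x)) + M.γ *
    ⨅ p : M.klBall x,
      ∫ s', (∫ a', (Q (s', a') - M.α * Real.log (π.prob s' a')) ∂(π.1 s')) ∂(p.1 : Measure S)

/-- The Boltzmann distribution `exp (Q(s, ·) / α) / Z(s)` on the actions. -/
def boltzmann (Q : S × A → ℝ) (s : S) : Measure A :=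
  Measure.count.tilted (fun a => Q (s, a) / M.α)

/-- `Q` is the outcome of policy evaluation for `π`, started from `Q₀`: the limit of the
iterates of the robust soft Bellman operator. -/
def IsEvaluation (π : Policy S A) (Q₀ Q : S × A → ℝ) : Prop :=
  ∀ x, Tendsto (fun n : ℕ => (M.bellman π)^[n] Q₀ x) atTop (𝓝 (Q x))

/-- `π` is the outcome of policy improvement for `Q`: at every state it minimizes, over all
policies, the Kullback-Leibler divergence to the Boltzmann distribution. -/
def IsImprovement (Q : S × A → ℝ) (π : Policy S A) : Prop :=
  ∀ (s : S) (π' : Policy S A),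
    InformationTheory.klDiv (π.1 s) (M.boltzmann Q s) ≤
      InformationTheory.klDiv (π'.1 s) (M.boltzmann Q s)

/-- A run of distributionally robust soft policy iteration from the policy `π₀`, whose `k`-th
policy evaluation is started from `Q₀ k`. -/
structure IsPolicyIteration (π₀ : Policy S A) (Q₀ : ℕ → S × A → ℝ)
    (π : ℕ → Policy S A) (Q : ℕ → S × A → ℝ) : Prop where
  start : π 0 = π₀
  evaluation : ∀ k, M.IsEvaluation (π k) (Q₀ k) (Q k)
  improvement : ∀ k, M.IsImprovement (Q k) (π (k + 1))

end RobustMDP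

end DRSoft

end

/-!
Soft policy iteration is ordinary policy iteration for robust Bellman operators acting on bounded
measurable functions of the state-action pair; three points carry the argument.

*The worst mean over a Kullback-Leibler ball.* No regularity of the state space is assumed, so
neither the measurability in `(s, a)` of the infimum of the mean of `f` over the ball nor the
existence of measurable minimizing kernels is automatic. Both come from the exponential tilts
`exp (t f) p⁰ / Z` with `t ≤ 0`: by the Gibbs variational inequality the tilt whose divergence
equals the radius minimizes the mean over the ball, and if no tilt reaches the radius, the means of
the tilts tend to the infimum as `t → -∞`. By continuity rational parameters suffice up to `ε`
(`exists_rat_tilt`), and a measurable choice among countably many kernels yields one transition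
model that is `ε`-worst at all state-action pairs at once (`exists_kernel_almost_worst`).

*Values as fixed points.* The robust soft Bellman operator of a policy is a monotone
`γ`-contraction, so it has a bounded measurable fixed point `Q`. For a fixed transition model the
marginal laws of the process turn the expected discounted sum into a series, along which
sub- and supersolutions of the linear Bellman equation telescope (`le_discountedValue`,
`discountedValue_le`). With the entropy bonus added, `Q` is a subsolution for every model of the
ambiguity set and almost a supersolution for the `ε`-worst model. Hence the fixed point is the
robust Q-function, its entropy-regularized mean is the robust value (`robustQ_eq_of_fixedPoint`,
`robustV_eq_of_fixedPoint`), and policy evaluation converges to it.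

*Improvement.* The entropy-regularized mean of `Q (s, ·)` falls short of the soft maximum of
`Q (s, ·)` by `α` times the divergence of the policy from the Boltzmann distribution
(`softMax_sub_policyMean`). So the Boltzmann policy of the fixed point `Q⋆` of the optimality
operator is optimal, and it is the only optimal policy because the equality case of the Gibbs
inequality is strict. A greedy step does at least as well as one step of value iteration
(`optBellman_le_robustQ_boltzmannPolicy`), which gives `|Q_k - Q⋆| ≤ C γ ^ k` uniformly; the
Boltzmann distribution depends on `Q` in a uniformly Lipschitz way, so the policies converge
uniformly.
-/

noncomputable section

namespace DRSoft

open InformationTheory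

/-! ### Bounded measurable functions -/

/-- A real function is bounded measurable: the class of functions on which the Bellman operators
act. -/
def BddMeasurable {X : Type*} [MeasurableSpace X] (f : X → ℝ) : Prop :=
  Measurable f ∧ ∃ C : ℝ, ∀ x, |f x| ≤ C

section Tilt

variable {S : Type*} [MeasurableSpace S]

lemma BddMeasurable.integrable {f : S → ℝ} (hf : BddMeasurable f) (μ : Measure S)
    [IsFiniteMeasure μ] : Integrable f μ := by
  obtain ⟨hm, C, hC⟩ := hf
  exact Integrable.of_bound hm.aestronglyMeasurable C (ae_of_all _ hC)

lemma abs_integral_le_of_abs_le {f : S → ℝ} {C : ℝ} (hC : ∀ s, |f s| ≤ C) (μ : Measure S)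
    [IsProbabilityMeasure μ] : |∫ s, f s ∂μ| ≤ C := by
  have h : ∀ s, ‖f s‖ ≤ C := hC
  simpa using norm_integral_le_of_norm_le_const (μ := μ) (ae_of_all _ h)

lemma BddMeasurable.exp_mul {f : S → ℝ} (hf : BddMeasurable f) (t : ℝ) :
    BddMeasurable fun s => Real.exp (t * f s) := by
  obtain ⟨hm, C, hC⟩ := hf
  refine ⟨by fun_prop, Real.exp (|t| * C), fun s => ?_⟩
  rw [abs_of_pos (Real.exp_pos _), Real.exp_le_exp]
  exact (le_abs_self _).trans (by rw [abs_mul]; gcongr; exact hC s)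

lemma BddMeasurable.add {f g : S → ℝ} (hf : BddMeasurable f) (hg : BddMeasurable g) :
    BddMeasurable fun s => f s + g s := by
  obtain ⟨hm, C, hC⟩ := hf
  obtain ⟨hm', C', hC'⟩ := hg
  exact ⟨hm.add hm', C + C', fun s => (abs_add_le _ _).trans (add_le_add (hC s) (hC' s))⟩

lemma BddMeasurable.const_mul {f : S → ℝ} (hf : BddMeasurable f) (c : ℝ) :
    BddMeasurable fun s => c * f s := by
  obtain ⟨hm, C, hC⟩ := hf
  refine ⟨hm.const_mul c, |c| * C, fun s => ?_⟩
  rw [abs_mul]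
  exact mul_le_mul_of_nonneg_left (hC s) (abs_nonneg c)

lemma BddMeasurable.mul {f g : S → ℝ} (hf : BddMeasurable f) (hg : BddMeasurable g) :
    BddMeasurable fun s => f s * g s := by
  obtain ⟨hm, C, hC⟩ := hf
  obtain ⟨hm', C', hC'⟩ := hg
  refine ⟨hm.mul hm', C * C', fun s => ?_⟩
  rw [abs_mul]
  exact mul_le_mul (hC s) (hC' s) (abs_nonneg _) ((abs_nonneg _).trans (hC s))

variable {μ : Measure S} [IsProbabilityMeasure μ] {f : S → ℝ} {δ : ℝ}

lemma BddMeasurable.mem_interior_integrableExpSet (hf : BddMeasurable f) (t : ℝ) :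
    t ∈ interior (integrableExpSet f μ) := by
  have : integrableExpSet f μ = Set.univ :=
    Set.eq_univ_of_forall fun t => (hf.exp_mul t).integrable μ
  simp [this]

lemma continuous_cgf (hf : BddMeasurable f) : Continuous (cgf f μ) :=
  continuous_iff_continuousAt.2 fun _ =>
    (analyticAt_cgf (hf.mem_interior_integrableExpSet _)).continuousAt

lemma continuous_deriv_cgf (hf : BddMeasurable f) : Continuous (deriv (cgf f μ)) :=
  continuous_iff_continuousAt.2 fun _ =>
    (analyticAt_cgf (hf.mem_interior_integrableExpSet _)).deriv.continuousAt

/-! ### Exponential tilts and Kullback-Leibler balls -/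

/-- The Kullback-Leibler divergence from `μ` to its exponential tilt by `t * f`, in terms of the
cumulant generating function; see `klDiv_tilted`. -/
def tiltCost (μ : Measure S) (f : S → ℝ) (t : ℝ) : ℝ := t * deriv (cgf f μ) t - cgf f μ t

lemma isProbabilityMeasure_tilted_mul (hf : BddMeasurable f) (t : ℝ) :
    IsProbabilityMeasure (μ.tilted fun s => t * f s) :=
  isProbabilityMeasure_tilted ((hf.exp_mul t).integrable μ)

lemma integral_tilted_mul (hf : BddMeasurable f) (t : ℝ) :
    ∫ s, f s ∂(μ.tilted fun s => t * f s) = deriv (cgf f μ) t :=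
  integral_tilted_mul_self (hf.mem_interior_integrableExpSet t)

lemma integral_llr_tilted_mul (hf : BddMeasurable f) (t : ℝ) :
    Integrable (llr (μ.tilted fun s => t * f s) μ) (μ.tilted fun s => t * f s) ∧
      ∫ s, llr (μ.tilted fun s => t * f s) μ s ∂(μ.tilted fun s => t * f s) = tiltCost μ f t := by
  have := isProbabilityMeasure_tilted_mul (μ := μ) hf t
  have hint := (hf.integrable (μ.tilted fun s => t * f s)).const_mul t
  have h : llr (μ.tilted fun s => t * f s) μ =ᵐ[μ.tilted fun s => t * f s]
      fun s => t * f s - cgf f μ t :=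
    (tilted_absolutelyContinuous μ _).ae_le
      (log_rnDeriv_tilted_left_self ((hf.exp_mul t).integrable μ))
  refine ⟨(hint.sub (integrable_const _)).congr h.symm, ?_⟩
  rw [integral_congr_ae h, integral_sub hint (integrable_const _), integral_const_mul,
    integral_tilted_mul hf]
  simp [tiltCost]

lemma klDiv_tilted (hf : BddMeasurable f) (t : ℝ) :
    klDiv (μ.tilted fun s => t * f s) μ = ENNReal.ofReal (tiltCost μ f t) := by
  have := isProbabilityMeasure_tilted_mul (μ := μ) hf t
  obtain ⟨h1, h2⟩ := integral_llr_tilted_mul (μ := μ) hf t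
  rw [klDiv_of_ac_of_integrable (tilted_absolutelyContinuous μ _) h1, h2]
  simp

lemma tiltCost_nonneg (hf : BddMeasurable f) (t : ℝ) : 0 ≤ tiltCost μ f t := by
  have := isProbabilityMeasure_tilted_mul (μ := μ) hf t
  obtain ⟨h1, h2⟩ := integral_llr_tilted_mul (μ := μ) hf t
  have := integral_llr_add_sub_measure_univ_nonneg (tilted_absolutelyContinuous μ _) h1
  rw [h2] at this
  simpa using this

/-- The Gibbs variational inequality: on a Kullback-Leibler ball, the exponential moments of `f`
under the centre control the mean of `f`. -/
lemma mul_integral_sub_cgf_le (hf : BddMeasurable f) (hδ : 0 ≤ δ) (t : ℝ) {p : Measure S}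
    [IsProbabilityMeasure p] (hp : klDiv p μ ≤ ENNReal.ofReal δ) :
    t * ∫ s, f s ∂p - cgf f μ t ≤ δ := by
  have := isProbabilityMeasure_tilted_mul (μ := μ) hf t
  obtain ⟨hac, hint⟩ := klDiv_ne_top_iff.1 (hp.trans_lt ENNReal.ofReal_lt_top).ne
  have hexp := (hf.exp_mul t).integrable μ
  have hfp := (hf.integrable p).const_mul t
  have h := integral_llr_add_sub_measure_univ_nonneg (hac.trans (absolutelyContinuous_tilted hexp))
    (integrable_llr_tilted_right hac hfp hint hexp)
  rw [integral_llr_tilted_right hac hfp hexp hint, integral_const_mul] at h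
  rw [klDiv_of_ac_of_integrable hac hint, ENNReal.ofReal_le_ofReal_iff hδ] at hp
  simp only [probReal_univ, add_sub_cancel_right] at h hp
  have : cgf f μ t = Real.log (∫ s, Real.exp (t * f s) ∂μ) := rfl
  linarith

/-- Over a Kullback-Leibler ball the mean of a bounded function is minimized, up to `ε`, by an
exponential tilt of the centre with a rational parameter. -/
lemma exists_rat_tilt (hf : BddMeasurable f) (hδ : 0 < δ) {ε : ℝ} (hε : 0 < ε) :
    ∃ t : ℚ, tiltCost μ f t ≤ δ ∧ ∀ p : Measure S, IsProbabilityMeasure p →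
      klDiv p μ ≤ ENNReal.ofReal δ → deriv (cgf f μ) t ≤ ∫ s, f s ∂p + ε := by
  have hcont : Continuous (tiltCost μ f) :=
    (continuous_id.mul (continuous_deriv_cgf hf)).sub (continuous_cgf hf)
  by_cases h : ∃ t ≤ 0, δ ≤ tiltCost μ f t
  · -- The tilt with the parameter closest to `0` whose cost reaches `δ` is optimal; rational
    -- parameters closer to `0` are admissible and approximate it.
    set E : Set ℝ := {t | t ≤ 0 ∧ δ ≤ tiltCost μ f t}
    have hE : IsClosed E := (isClosed_le continuous_id continuous_const).inter
      (isClosed_le continuous_const hcont)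
    have hbdd : BddAbove E := ⟨0, fun t ht => ht.1⟩
    have hmem : sSup E ∈ E := hE.csSup_mem (by obtain ⟨t, h⟩ := h; exact ⟨t, h⟩) hbdd
    set t₀ := sSup E
    have ht₀ : t₀ < 0 := by
      refine lt_of_le_of_ne hmem.1 fun h0 => ?_
      have := hmem.2
      rw [h0] at this
      simp [tiltCost] at this
      linarith
    have hev : ∀ᶠ t in 𝓝[>] t₀, deriv (cgf f μ) t < deriv (cgf f μ) t₀ + ε :=
      nhdsWithin_le_nhds ((continuous_deriv_cgf hf).continuousAt.eventually_lt_const (by linarith))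
    obtain ⟨u, hu, hsub⟩ := (mem_nhdsGT_iff_exists_Ioo_subset).1 hev
    obtain ⟨t, ht1, ht2⟩ := exists_rat_btwn (lt_min hu ht₀)
    rw [lt_min_iff] at ht2
    refine ⟨t, ?_, fun p _ hp => ?_⟩
    · by_contra hc
      exact absurd (le_csSup hbdd (show (t : ℝ) ∈ E from ⟨ht2.2.le, (not_le.1 hc).le⟩))
        (not_le.2 ht1)
    · have h1 := mul_integral_sub_cgf_le hf hδ.le t₀ hp
      have h2 : δ ≤ t₀ * deriv (cgf f μ) t₀ - cgf f μ t₀ := hmem.2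
      have h3 : t₀ * ∫ s, f s ∂p ≤ t₀ * deriv (cgf f μ) t₀ := by linarith
      have h4 := (mul_le_mul_left_of_neg ht₀).1 h3
      have h5 : deriv (cgf f μ) t < deriv (cgf f μ) t₀ + ε := hsub ⟨ht1, ht2.1⟩
      linarith
  · -- Every tilt is admissible, and the duality gap at `t` is at most `δ / |t|`.
    push Not at h
    obtain ⟨t, ht⟩ := exists_rat_lt (-(δ / ε))
    have ht0 : (t : ℝ) < 0 := ht.trans (neg_neg_of_pos (div_pos hδ hε))
    refine ⟨t, (h t ht0.le).le, fun p _ hp => ?_⟩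
    have h1 := mul_integral_sub_cgf_le hf hδ.le t hp
    have h2 : 0 ≤ t * deriv (cgf f μ) t - cgf f μ t := tiltCost_nonneg hf t
    have h3 : δ < -t * ε := by
      rw [lt_neg, div_lt_iff₀ hε] at ht
      linarith
    by_contra hc
    push Not at hc
    nlinarith

end Tilt

/-! ### Measurable selection of almost worst kernels -/

section Selection

variable {X S : Type*} [MeasurableSpace X] [MeasurableSpace S]

lemma BddMeasurable.integral_kernel {f : S → ℝ} (hf : BddMeasurable f) (κ : Kernel X S)
    [IsMarkovKernel κ] : BddMeasurable fun x => ∫ s, f s ∂κ x := by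
  obtain ⟨hm, C, hC⟩ := hf
  refine ⟨hm.stronglyMeasurable.integral_kernel.measurable, C,
    fun x => abs_integral_le_of_abs_le hC _⟩

lemma BddMeasurable.measurable_cgf {f : S → ℝ} (hf : BddMeasurable f) (κ : Kernel X S)
    [IsMarkovKernel κ] (t : ℝ) : Measurable fun x => cgf f (κ x) t :=
  ((hf.exp_mul t).integral_kernel κ).1.log

lemma BddMeasurable.measurable_deriv_cgf {f : S → ℝ} (hf : BddMeasurable f) (κ : Kernel X S)
    [IsMarkovKernel κ] (t : ℝ) : Measurable fun x => deriv (cgf f (κ x)) t := by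
  simp_rw [fun x => deriv_cgf (hf.mem_interior_integrableExpSet (μ := κ x) t)]
  exact ((hf.mul (hf.exp_mul t)).integral_kernel κ).1.div ((hf.exp_mul t).integral_kernel κ).1

lemma BddMeasurable.measurable_tiltCost {f : S → ℝ} (hf : BddMeasurable f) (κ : Kernel X S)
    [IsMarkovKernel κ] (t : ℝ) : Measurable fun x => tiltCost (κ x) f t :=
  ((hf.measurable_deriv_cgf κ t).const_mul t).sub (hf.measurable_cgf κ t)

lemma BddMeasurable.measurable_tilted {f : S → ℝ} (hf : BddMeasurable f) (κ : Kernel X S)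
    [IsMarkovKernel κ] (t : ℝ) : Measurable fun x => (κ x).tilted fun s => t * f s := by
  refine Measure.measurable_of_measurable_coe _ fun B hB => ?_
  simp_rw [tilted_apply' _ _ hB]
  have hZ := ((hf.exp_mul t).integral_kernel κ).1
  have he := (hf.exp_mul t).1
  have hd : Measurable (Function.uncurry fun (x : X) (s : S) =>
      ENNReal.ofReal (Real.exp (t * f s) / ∫ s', Real.exp (t * f s') ∂κ x)) :=
    ((he.comp measurable_snd).div (hZ.comp measurable_fst)).ennreal_ofReal
  exact hd.setLIntegral_kernel_prod_right hB

/-- The kernel `x ↦ (κ x).tilted (t * f)`. -/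
def tiltedKernel (κ : Kernel X S) [IsMarkovKernel κ] {f : S → ℝ} (hf : BddMeasurable f) (t : ℝ) :
    Kernel X S where
  toFun x := (κ x).tilted fun s => t * f s
  measurable' := hf.measurable_tilted κ t

/-- The kernel that follows the `n x`-th kernel of a sequence at the point `x`. -/
def selectKernel (η : ℕ → Kernel X S) (n : X → ℕ) (hn : Measurable n) : Kernel X S where
  toFun x := η (n x) x
  measurable' := by
    have h : Measurable fun q : X × ℕ => η q.2 q.1 :=
      measurable_from_prod_countable_left fun i => (η i).measurable
    exact h.comp (measurable_id.prodMk hn)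

/-- Measurable selection of almost worst distributions from Kullback-Leibler balls: no regularity
of the space is needed, since rational exponential tilts suffice. -/
theorem exists_kernel_almost_worst (κ : Kernel X S) [IsMarkovKernel κ] {f : S → ℝ}
    (hf : BddMeasurable f) {δ : ℝ} (hδ : 0 < δ) {ε : ℝ} (hε : 0 < ε) :
    ∃ η : Kernel X S, IsMarkovKernel η ∧ (∀ x, klDiv (η x) (κ x) ≤ ENNReal.ofReal δ) ∧
      ∀ x (p : Measure S), IsProbabilityMeasure p → klDiv p (κ x) ≤ ENNReal.ofReal δ →
        ∫ s, f s ∂η x ≤ ∫ s, f s ∂p + ε := by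
  obtain ⟨C, hC⟩ := hf.2
  obtain ⟨e, he⟩ := exists_surjective_nat ℚ
  -- The means of the admissible rational tilts, inadmissible ones counting as `C + 1`, which
  -- exceeds every admissible mean by `1`.
  let g : ℕ → X → ℝ := fun n x =>
    if tiltCost (κ x) f (e n) ≤ δ then deriv (cgf f (κ x)) (e n) else C + 1
  have hcost := fun n =>
    measurableSet_le (hf.measurable_tiltCost κ (e n)) (measurable_const (a := δ))
  have hg : ∀ n, Measurable (g n) := fun n =>
    Measurable.ite (hcost n) (hf.measurable_deriv_cgf κ _) measurable_const
  have hmean : ∀ (p : Measure S), IsProbabilityMeasure p → |∫ s, f s ∂p| ≤ C :=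
    fun p _ => abs_integral_le_of_abs_le hC p
  have hderiv : ∀ x t, |deriv (cgf f (κ x)) t| ≤ C := fun x t => by
    rw [← integral_tilted_mul hf]
    exact hmean _ (isProbabilityMeasure_tilted_mul hf t)
  have hbdd : ∀ x, BddBelow (Set.range fun n => g n x) := fun x => by
    refine ⟨-C, ?_⟩
    rintro _ ⟨n, rfl⟩
    simp only [g]
    have h1 := (abs_le.1 (hderiv x (e n))).1
    have h2 := (abs_nonneg _).trans (hderiv x (e n))
    split_ifs <;> linarith
  have hI : Measurable fun x => ⨅ n, g n x := Measurable.iInf hg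
  -- Slack below `1` rules out inadmissible indices, since the tilt by `0` is admissible.
  have hex : ∀ x, ∃ n, tiltCost (κ x) f (e n) ≤ δ ∧
      deriv (cgf f (κ x)) (e n) ≤ (⨅ n, g n x) + ε / 2 := fun x => by
    obtain ⟨n, hn⟩ := exists_lt_of_ciInf_lt
      (show (⨅ n, g n x) < (⨅ n, g n x) + min (ε / 2) 1 from lt_add_of_pos_right _ (by positivity))
    obtain ⟨m, hm⟩ := he 0
    have hm' : g m x ≤ C := by
      simp only [g, hm, Rat.cast_zero]
      rw [if_pos (by simp [tiltCost, hδ.le])]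
      exact (abs_le.1 (hderiv x 0)).2
    have h1 := ciInf_le (hbdd x) m
    have h2 := min_le_left (ε / 2) 1
    have h3 := min_le_right (ε / 2) 1
    refine ⟨n, ?_⟩
    by_cases hc : tiltCost (κ x) f (e n) ≤ δ
    · simp only [g, if_pos hc] at hn
      exact ⟨hc, by simp only [g]; linarith⟩
    · exfalso
      simp only [g, if_neg hc] at hn hm' h1
      linarith
  classical
  let n : X → ℕ := fun x => Nat.find (hex x)
  have hn : Measurable n := measurable_find hex fun k =>
    (hcost k).inter (measurableSet_le (hf.measurable_deriv_cgf κ _) (hI.add_const _))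
  refine ⟨selectKernel (fun k => tiltedKernel κ hf (e k)) n hn,
    ⟨fun x => isProbabilityMeasure_tilted_mul hf _⟩, fun x => ?_, fun x p hp hpδ => ?_⟩
  · change klDiv ((κ x).tilted fun s => _ * f s) (κ x) ≤ _
    rw [klDiv_tilted hf]
    exact ENNReal.ofReal_le_ofReal (Nat.find_spec (hex x)).1
  · change ∫ s, f s ∂((κ x).tilted fun s => _ * f s) ≤ _
    rw [integral_tilted_mul hf]
    obtain ⟨t, ht1, ht2⟩ := exists_rat_tilt (μ := κ x) hf hδ (half_pos hε)
    obtain ⟨m, rfl⟩ := he t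
    have h1 := (Nat.find_spec (hex x)).2
    have h2 := ciInf_le (hbdd x) m
    simp only [g] at h2
    rw [if_pos ht1] at h2
    have h3 := ht2 p hp hpδ
    refine h1.trans ?_
    simp only [g]
    linarith

end Selection

namespace RobustMDP

variable {S A : Type*} [MeasurableSpace S] [MeasurableSpace A] (M : RobustMDP S A)

/-- The worst mean of `f` at the next state, over the Kullback-Leibler ball around the nominal
distribution. -/
def worstMean (f : S → ℝ) (x : S × A) : ℝ := ⨅ p : M.klBall x, ∫ s, f s ∂(p.1 : Measure S)

variable {M} {f g : S → ℝ}

instance (x : S × A) : Nonempty (M.klBall x) :=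
  ⟨⟨⟨M.nominal.1 x, inferInstance⟩, (klDiv_self (M.nominal.1 x)).trans_le zero_le⟩⟩

lemma bddBelow_mean (hf : BddMeasurable f) (x : S × A) :
    BddBelow (Set.range fun p : M.klBall x => ∫ s, f s ∂(p.1 : Measure S)) := by
  obtain ⟨hm, C, hC⟩ := hf
  refine ⟨-C, ?_⟩
  rintro _ ⟨p, rfl⟩
  exact (abs_le.1 (abs_integral_le_of_abs_le hC _)).1

lemma worstMean_le (hf : BddMeasurable f) (x : S × A) (p : Measure S) [hp : IsProbabilityMeasure p]
    (h : klDiv p (M.nominal.1 x) ≤ ENNReal.ofReal M.δ) : M.worstMean f x ≤ ∫ s, f s ∂p :=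
  ciInf_le (bddBelow_mean hf x) ⟨⟨p, hp⟩, h⟩

/-- The worst mean is attained, up to `ε`, at all state-action pairs simultaneously by a transition
model of the ambiguity set. -/
lemma exists_ambiguitySet_le_worstMean (hf : BddMeasurable f) {ε : ℝ} (hε : 0 < ε) :
    ∃ p ∈ M.ambiguitySet, ∀ x, ∫ s, f s ∂p.1 x ≤ M.worstMean f x + ε := by
  obtain ⟨η, h1, h2, h3⟩ := exists_kernel_almost_worst M.nominal.1 hf M.δ_pos hε
  refine ⟨⟨η, h1⟩, h2, fun x => ?_⟩
  rw [← sub_le_iff_le_add]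
  exact le_ciInf fun p => sub_le_iff_le_add.2 (h3 x p.1 inferInstance p.2)

lemma worstMean_le_add (hf : BddMeasurable f) (hg : BddMeasurable g) {c : ℝ}
    (h : ∀ s, f s ≤ g s + c) (x : S × A) : M.worstMean f x ≤ M.worstMean g x + c := by
  rw [← sub_le_iff_le_add]
  refine le_ciInf fun p => sub_le_iff_le_add.2 ((ciInf_le (bddBelow_mean hf x) p).trans ?_)
  calc ∫ s, f s ∂(p.1 : Measure S) ≤ ∫ s, (g s + c) ∂(p.1 : Measure S) :=
        integral_mono (hf.integrable _) ((hg.integrable _).add (integrable_const _)) h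
    _ = _ := by rw [integral_add (hg.integrable _) (integrable_const _)]; simp

lemma worstMean_mono (hf : BddMeasurable f) (hg : BddMeasurable g) (h : ∀ s, f s ≤ g s)
    (x : S × A) : M.worstMean f x ≤ M.worstMean g x := by
  simpa using worstMean_le_add hf hg (c := 0) (by simpa using h) x

lemma bddMeasurable_worstMean (hf : BddMeasurable f) : BddMeasurable (M.worstMean f) := by
  have hpos : ∀ n : ℕ, (0 : ℝ) < 1 / (n + 1) := fun n => by positivity
  choose p hp hle using fun n => exists_ambiguitySet_le_worstMean (M := M) hf (hpos n)
  refine ⟨measurable_of_tendsto_metrizable (fun n => (hf.integral_kernel (p n).1).1)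
    (tendsto_pi_nhds.2 fun x => ?_), ?_⟩
  · have h := (tendsto_const_nhds (x := M.worstMean f x)).add
      (tendsto_one_div_add_atTop_nhds_zero_nat (𝕜 := ℝ))
    rw [add_zero] at h
    exact tendsto_of_tendsto_of_tendsto_of_le_of_le tendsto_const_nhds h
      (fun n => worstMean_le hf x _ (hp n x)) fun n => hle n x
  · obtain ⟨hm, C, hC⟩ := hf
    refine ⟨C, fun x => abs_le.2 ⟨le_ciInf fun p => ?_, ?_⟩⟩
    · exact (abs_le.1 (abs_integral_le_of_abs_le hC _)).1
    · refine (worstMean_le ⟨hm, C, hC⟩ x (M.nominal.1 x) (by simp)).trans ?_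
      exact (abs_le.1 (abs_integral_le_of_abs_le hC _)).2

end RobustMDP

/-! ### The law of the controlled process -/

namespace RobustMDP
variable {S A : Type*} [MeasurableSpace S] [MeasurableSpace A] {M : RobustMDP S A}
  {p : TransitionModel S A} {π : Policy S A}

lemma comap_comp_measure {X Y Z : Type*} [MeasurableSpace X] [MeasurableSpace Y]
    [MeasurableSpace Z] (κ : Kernel Y Z) {g : X → Y} (hg : Measurable g) (μ : Measure X) :
    κ.comap g hg ∘ₘ μ = κ ∘ₘ μ.map g := by
  rw [← Kernel.comp_deterministic_eq_comap, ← Measure.comp_assoc,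
    Measure.deterministic_comp_eq_map]

lemma map_eval_zero_processLaw (init : Measure ((S × A) × ℝ)) [IsProbabilityMeasure init] :
    (M.processLaw p π init).map (fun ω => ω 0) = init := by
  let e : ((i : Finset.Iic 0) → (S × A) × ℝ) → (S × A) × ℝ := fun h => h ⟨0, by simp⟩
  have he : Measurable e := measurable_pi_apply _
  have h : (fun ω : ℕ → (S × A) × ℝ => ω 0) = e ∘ Preorder.frestrictLe 0 := rfl
  unfold processLaw Kernel.trajMeasure
  rw [h, ← Measure.map_map he (by fun_prop), Measure.map_comp _ _ (by fun_prop),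
    Kernel.traj_map_frestrictLe, Kernel.partialTraj_self, Measure.id_comp,
    Measure.map_map he (by fun_prop)]
  exact Measure.map_id

lemma map_eval_succ_processLaw (init : Measure ((S × A) × ℝ)) [IsProbabilityMeasure init]
    (n : ℕ) : (M.processLaw p π init).map (fun ω => ω (n + 1)) =
      M.step p π ∘ₘ (M.processLaw p π init).map (fun ω => ω n) := by
  have h := congrArg Measure.snd (Kernel.map_frestrictLe_trajMeasure_compProd_eq_map_trajMeasure
    (X := fun _ => (S × A) × ℝ) (μ₀ := init) (a := n)
    (κ := fun n => (M.step p π).comap (fun h => h ⟨n, by simp⟩) (measurable_pi_apply _)))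
  rw [Measure.snd_compProd, Measure.snd_map_prodMk (by fun_prop), comap_comp_measure,
    Measure.map_map (measurable_pi_apply _) (by fun_prop)] at h
  exact h.symm

/-- The transition kernel of the state-action pairs `(s_t, a_t)`. -/
def pairKernel (p : TransitionModel S A) (π : Policy S A) : Kernel (S × A) (S × A) :=
  drawAction π ∘ₖ p.1

instance : IsMarkovKernel (pairKernel p π) := by unfold pairKernel; infer_instance

/-- The law of the state-action pair `(s_t, a_t)` when `(s_0, a_0)` has the law `ν`. -/
def pairLaw (p : TransitionModel S A) (π : Policy S A) (ν : Measure (S × A)) : ℕ → Measure (S × A)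
  | 0 => ν
  | n + 1 => pairKernel p π ∘ₘ pairLaw p π ν n

instance (ν : Measure (S × A)) [IsProbabilityMeasure ν] (n : ℕ) :
    IsProbabilityMeasure (pairLaw p π ν n) := by
  induction n with
  | zero => exact ‹_›
  | succ n ih => unfold pairLaw; infer_instance

lemma drawReward_comp (ν : Measure (S × A)) [IsProbabilityMeasure ν] :
    M.drawReward ∘ₘ ν = ν ⊗ₘ M.reward := (Measure.compProd_eq_comp_prod _ _).symm

/-- At every time the reward is drawn from the reward kernel at the current state-action pair, whose
law is the iterate of `pairKernel`. -/
lemma map_eval_processLaw (ν : Measure (S × A)) [IsProbabilityMeasure ν] (n : ℕ) :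
    (M.processLaw p π (M.drawReward ∘ₘ ν)).map (fun ω => ω n) =
      pairLaw p π ν n ⊗ₘ M.reward := by
  rw [← drawReward_comp]
  induction n with
  | zero => exact map_eval_zero_processLaw _
  | succ n ih =>
    rw [map_eval_succ_processLaw, ih, step, comap_comp_measure, drawReward_comp]
    change _ ∘ₘ (_ ⊗ₘ _).fst = _
    rw [Measure.fst_compProd, pairLaw, Measure.comp_assoc]
    rfl

lemma ae_reward_mem (ν : Measure (S × A)) [IsProbabilityMeasure ν] :
    ∀ᵐ ω ∂M.processLaw p π (M.drawReward ∘ₘ ν), ∀ n, (ω n).2 ∈ Set.Icc 0 M.Rmax := by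
  refine ae_all_iff.2 fun n => ?_
  have h : ∀ᵐ z ∂(pairLaw p π ν n ⊗ₘ M.reward), z.2 ∈ Set.Icc 0 M.Rmax :=
    Measure.ae_compProd_of_ae_ae (measurable_snd measurableSet_Icc) (ae_of_all _ M.reward_mem)
  rw [← map_eval_processLaw] at h
  exact ae_of_ae_map (measurable_pi_apply n).aemeasurable h

variable (M) in
/-- The mean reward at a state-action pair. -/
def meanReward (x : S × A) : ℝ := ∫ r, r ∂M.reward x

lemma abs_meanReward_le (x : S × A) : |M.meanReward x| ≤ M.Rmax := by
  have h : ∀ᵐ r ∂M.reward x, ‖r‖ ≤ M.Rmax :=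
    (M.reward_mem x).mono fun r hr => by rw [Real.norm_of_nonneg hr.1]; exact hr.2
  simpa [meanReward] using norm_integral_le_of_norm_le_const h

lemma bddMeasurable_meanReward : BddMeasurable M.meanReward :=
  ⟨measurable_id.stronglyMeasurable.integral_kernel.measurable, M.Rmax, abs_meanReward_le⟩

/-- The mean at time `n` of the reward and of a bounded function of the state-action pair. The
reward is bounded only almost surely, so its integrability is part of the claim. -/
lemma integral_pair_reward (ν : Measure (S × A)) [IsProbabilityMeasure ν] {h : S × A → ℝ}
    (hh : BddMeasurable h) (n : ℕ) :
    Integrable (fun ω => (ω n).2 + h (ω n).1) (M.processLaw p π (M.drawReward ∘ₘ ν)) ∧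
    ∫ ω, (ω n).2 + h (ω n).1 ∂M.processLaw p π (M.drawReward ∘ₘ ν) =
      ∫ x, (M.meanReward x + h x) ∂pairLaw p π ν n := by
  have hmeas : Measurable fun z : (S × A) × ℝ => z.2 + h z.1 :=
    measurable_snd.add (hh.1.comp measurable_fst)
  obtain ⟨C, hC⟩ := hh.2
  have hint : Integrable (fun z : (S × A) × ℝ => z.2 + h z.1) (pairLaw p π ν n ⊗ₘ M.reward) := by
    refine Integrable.of_bound hmeas.aestronglyMeasurable (M.Rmax + C) ?_
    have : ∀ᵐ z ∂(pairLaw p π ν n ⊗ₘ M.reward), z.2 ∈ Set.Icc 0 M.Rmax :=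
      Measure.ae_compProd_of_ae_ae (measurable_snd measurableSet_Icc) (ae_of_all _ M.reward_mem)
    filter_upwards [this] with z hz
    refine (norm_add_le _ _).trans (add_le_add ?_ (hC _))
    rw [Real.norm_of_nonneg hz.1]
    exact hz.2
  have hr : ∀ x, Integrable (fun r : ℝ => r) (M.reward x) := fun x =>
    Integrable.of_bound measurable_id.aestronglyMeasurable M.Rmax
      ((M.reward_mem x).mono fun r hr => by rw [Real.norm_of_nonneg hr.1]; exact hr.2)
  rw [← map_eval_processLaw] at hint
  refine ⟨hint.comp_measurable (measurable_pi_apply n), ?_⟩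
  rw [← integral_map (φ := fun ω : ℕ → (S × A) × ℝ => ω n)
    (measurable_pi_apply n).aemeasurable hmeas.aestronglyMeasurable]
  rw [map_eval_processLaw] at hint ⊢
  rw [Measure.integral_compProd hint]
  refine integral_congr_ae (ae_of_all _ fun x => ?_)
  simp only
  rw [integral_add (hr x) (integrable_const _)]
  simp [meanReward]

end RobustMDP

/-! ### Discounted values of a fixed model -/

namespace RobustMDP
variable {S A : Type*} [MeasurableSpace S] [MeasurableSpace A] {M : RobustMDP S A}
  {p : TransitionModel S A} {π : Policy S A}

lemma summable_discounted {γ C : ℝ} (h0 : 0 ≤ γ) (h1 : γ < 1) {a : ℕ → ℝ} (ha : ∀ t, |a t| ≤ C) :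
    Summable fun t => γ ^ t * a t := by
  refine Summable.of_norm_bounded ((summable_geometric_of_lt_one h0 h1).mul_right C) fun t => ?_
  rw [norm_mul, Real.norm_of_nonneg (pow_nonneg h0 t)]
  exact mul_le_mul_of_nonneg_left (ha t) (pow_nonneg h0 t)

lemma abs_discounted_le {γ C : ℝ} (h0 : 0 ≤ γ) (h1 : γ < 1) {a : ℕ → ℝ} (ha : ∀ t, |a t| ≤ C) :
    |∑' t, γ ^ t * a t| ≤ (1 - γ)⁻¹ * C := by
  rw [← Real.norm_eq_abs]
  refine tsum_of_norm_bounded ((hasSum_geometric_of_lt_one h0 h1).mul_right C) fun t => ?_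
  rw [norm_mul, Real.norm_of_nonneg (pow_nonneg h0 t)]
  exact mul_le_mul_of_nonneg_left (ha t) (pow_nonneg h0 t)

lemma ae_abs_reward_add_le (ν : Measure (S × A)) [IsProbabilityMeasure ν] {h : S × A → ℝ} {C : ℝ}
    (hC : ∀ x, |h x| ≤ C) : ∀ᵐ ω ∂M.processLaw p π (M.drawReward ∘ₘ ν),
      ∀ t, |(ω t).2 + h (ω t).1| ≤ M.Rmax + C := by
  filter_upwards [ae_reward_mem ν] with ω hω t
  exact (abs_add_le _ _).trans
    (add_le_add (by rw [abs_of_nonneg (hω t).1]; exact (hω t).2) (hC _))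

lemma integrable_discounted (ν : Measure (S × A)) [IsProbabilityMeasure ν] {h : S × A → ℝ}
    (hh : BddMeasurable h) :
    Integrable (fun ω => ∑' t : ℕ, M.γ ^ t * ((ω t).2 + h (ω t).1))
      (M.processLaw p π (M.drawReward ∘ₘ ν)) := by
  obtain ⟨C, hC⟩ := hh.2
  have : IsProbabilityMeasure (M.processLaw p π (M.drawReward ∘ₘ ν)) := by
    unfold processLaw; infer_instance
  have hae := ae_abs_reward_add_le (M := M) (p := p) (π := π) ν hC
  refine Integrable.of_bound (aestronglyMeasurable_of_tendsto_ae atTop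
    (f := fun (n : ℕ) ω => ∑ t ∈ Finset.range n, M.γ ^ t * ((ω t).2 + h (ω t).1))
    (fun n => ?_) ?_) ((1 - M.γ)⁻¹ * (M.Rmax + C)) ?_
  · exact (integrable_finsetSum _ fun t _ =>
      (integral_pair_reward ν hh t).1.const_mul (M.γ ^ t)).aestronglyMeasurable
  · filter_upwards [hae] with ω hω
    exact (summable_discounted M.γ_nonneg M.γ_lt_one hω).hasSum.tendsto_sum_nat
  · filter_upwards [hae] with ω hω
    exact abs_discounted_le M.γ_nonneg M.γ_lt_one hω

lemma integral_discounted (ν : Measure (S × A)) [IsProbabilityMeasure ν] {h : S × A → ℝ}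
    (hh : BddMeasurable h) :
    ∫ ω, ∑' t : ℕ, M.γ ^ t * ((ω t).2 + h (ω t).1) ∂M.processLaw p π (M.drawReward ∘ₘ ν) =
      ∑' t : ℕ, M.γ ^ t * ∫ x, (M.meanReward x + h x) ∂pairLaw p π ν t := by
  obtain ⟨C, hC⟩ := hh.2
  have : IsProbabilityMeasure (M.processLaw p π (M.drawReward ∘ₘ ν)) := by
    unfold processLaw; infer_instance
  have h1 : ∀ t, Integrable (fun ω => M.γ ^ t * ((ω t).2 + h (ω t).1))
      (M.processLaw p π (M.drawReward ∘ₘ ν)) :=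
    fun t => (integral_pair_reward ν hh t).1.const_mul _
  have h2 : Summable fun t => ∫ ω, ‖M.γ ^ t * ((ω t).2 + h (ω t).1)‖
      ∂M.processLaw p π (M.drawReward ∘ₘ ν) := by
    refine Summable.of_nonneg_of_le (fun t => integral_nonneg fun _ => norm_nonneg _) (fun t => ?_)
      ((summable_geometric_of_lt_one M.γ_nonneg M.γ_lt_one).mul_right (M.Rmax + C))
    have hle := (le_abs_self _).trans (norm_integral_le_of_norm_le_const
      (μ := M.processLaw p π (M.drawReward ∘ₘ ν))
      (f := fun ω => ‖M.γ ^ t * ((ω t).2 + h (ω t).1)‖)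
      (C := M.γ ^ t * (M.Rmax + C)) ?_)
    · simpa using hle
    filter_upwards [ae_abs_reward_add_le ν hC] with ω hω
    rw [norm_norm, norm_mul, Real.norm_of_nonneg (pow_nonneg M.γ_nonneg t)]
    exact mul_le_mul_of_nonneg_left (hω t) (pow_nonneg M.γ_nonneg t)
  rw [← (hasSum_integral_of_summable_integral_norm h1 h2).tsum_eq]
  refine tsum_congr fun t => ?_
  rw [integral_const_mul, (integral_pair_reward ν hh t).2]

/-- The entropy bonus, as a function of the state-action pair. -/
def bonus (M : RobustMDP S A) (π : Policy S A) (x : S × A) : ℝ := M.α * π.entropy x.1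

/-- The soft value of `π` under the model `p` when the first state-action pair has the law `ν`. -/
def discountedValue (M : RobustMDP S A) (p : TransitionModel S A) (π : Policy S A)
    (ν : Measure (S × A)) : ℝ :=
  ∑' t : ℕ, M.γ ^ t * ∫ x, (M.meanReward x + M.bonus π x) ∂pairLaw p π ν t

lemma modelV_eq (hb : BddMeasurable (M.bonus π)) (s : S) :
    M.modelV p π s = M.discountedValue p π (drawAction π s) :=
  integral_discounted (drawAction π s) hb

/-- The Q-function omits the entropy bonus of the initial state. -/
lemma modelQ_eq (hb : BddMeasurable (M.bonus π)) (x : S × A) :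
    M.modelQ p π x = M.discountedValue p π (Measure.dirac x) - M.bonus π x := by
  obtain ⟨C, hC⟩ := hb.2
  have hd : M.drawReward x = M.drawReward ∘ₘ Measure.dirac x :=
    (Measure.dirac_bind (Kernel.measurable _) _).symm
  have : IsProbabilityMeasure (M.processLaw p π (M.drawReward ∘ₘ Measure.dirac x)) := by
    unfold processLaw; infer_instance
  have hQ : M.modelQ p π x = ∫ ω, (ω 0).2 + ∑' t : ℕ, M.γ ^ (t + 1) *
      ((ω (t + 1)).2 + M.bonus π (ω (t + 1)).1)
        ∂M.processLaw p π (M.drawReward ∘ₘ Measure.dirac x) := by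
    simp only [← hd]; rfl
  have hfst : ∀ᵐ ω ∂M.processLaw p π (M.drawReward ∘ₘ Measure.dirac x),
      M.bonus π (ω 0).1 = M.bonus π x := by
    have h : ∀ᵐ z ∂(pairLaw p π (Measure.dirac x) 0 ⊗ₘ M.reward), M.bonus π z.1 = M.bonus π x := by
      refine Measure.ae_compProd_of_ae_fst (p := fun y => M.bonus π y = M.bonus π x) _
        (measurableSet_eq_fun hb.1 measurable_const) ?_
      change ∀ᵐ y ∂Measure.dirac x, _
      rw [ae_dirac_iff (measurableSet_eq_fun hb.1 measurable_const)]
    rw [← map_eval_processLaw] at h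
    exact ae_of_ae_map (measurable_pi_apply 0).aemeasurable h
  have hae : ∀ᵐ ω ∂M.processLaw p π (M.drawReward ∘ₘ Measure.dirac x),
      (ω 0).2 + ∑' t : ℕ, M.γ ^ (t + 1) * ((ω (t + 1)).2 + M.bonus π (ω (t + 1)).1) =
        (∑' t : ℕ, M.γ ^ t * ((ω t).2 + M.bonus π (ω t).1)) - M.bonus π x := by
    filter_upwards [hfst, ae_abs_reward_add_le (Measure.dirac x) hC] with ω h0 hω
    rw [(summable_discounted M.γ_nonneg M.γ_lt_one hω).tsum_eq_zero_add, h0]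
    ring
  rw [hQ, integral_congr_ae hae, integral_sub, integral_discounted _ hb]
  · simp [discountedValue]
  · exact integrable_discounted _ hb
  · exact integrable_const _

lemma hasSum_discounted_telescope {γ C : ℝ} (h0 : 0 ≤ γ) (h1 : γ < 1) {u : ℕ → ℝ}
    (hu : ∀ t, |u t| ≤ C) : HasSum (fun t => γ ^ t * (u t - γ * u (t + 1))) (u 0) := by
  have hs := summable_discounted h0 h1 hu
  have h := hs.hasSum.sub ((summable_nat_add_iff 1).2 hs).hasSum
  rw [hs.tsum_eq_zero_add, add_sub_cancel_right, pow_zero, one_mul] at h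
  exact h.congr_fun fun t => by ring

lemma integral_pairLaw_succ {W : S × A → ℝ} (hW : BddMeasurable W)
    (ν : Measure (S × A)) [IsProbabilityMeasure ν] (t : ℕ) :
    ∫ x, W x ∂pairLaw p π ν (t + 1) = ∫ x, ∫ y, W y ∂pairKernel p π x ∂pairLaw p π ν t := by
  have hW' := hW.integrable (pairLaw p π ν (t + 1))
  rw [pairLaw, Measure.comp_eq_comp_const_apply] at hW' ⊢
  rw [Kernel.integral_comp hW', Kernel.const_apply]

lemma summable_discountedValue (hb : BddMeasurable (M.bonus π)) (ν : Measure (S × A))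
    [IsProbabilityMeasure ν] :
    Summable fun t => M.γ ^ t * ∫ x, (M.meanReward x + M.bonus π x) ∂pairLaw p π ν t := by
  obtain ⟨C, hC⟩ := hb.2
  exact summable_discounted M.γ_nonneg M.γ_lt_one fun t => abs_integral_le_of_abs_le
    (fun x => (abs_add_le _ _).trans (add_le_add (abs_meanReward_le x) (hC x))) _

/-- A bounded supersolution of the linear Bellman inequality dominates the soft value, up to
`ε / (1 - γ)`. -/
lemma discountedValue_le (hb : BddMeasurable (M.bonus π)) {W : S × A → ℝ} (hW : BddMeasurable W)
    {ε : ℝ} (h : ∀ x, M.meanReward x + M.bonus π x + M.γ * ∫ y, W y ∂pairKernel p π x ≤ W x + ε)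
    (ν : Measure (S × A)) [IsProbabilityMeasure ν] :
    M.discountedValue p π ν ≤ ∫ x, W x ∂ν + ε / (1 - M.γ) := by
  have hg := (bddMeasurable_meanReward (M := M)).add hb
  have hK := hW.integral_kernel (pairKernel p π)
  obtain ⟨C, hC⟩ := hW.2
  have hle := (summable_discountedValue (p := p) hb ν).hasSum
  have htel := hasSum_discounted_telescope M.γ_nonneg M.γ_lt_one
    fun t => abs_integral_le_of_abs_le hC (pairLaw p π ν t)
  have h' := htel.add ((hasSum_geometric_of_lt_one M.γ_nonneg M.γ_lt_one).mul_right ε)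
  refine (hasSum_le (fun t => ?_) hle h').trans_eq (by rw [inv_mul_eq_div]; rfl)
  rw [← mul_add]
  refine mul_le_mul_of_nonneg_left ?_ (pow_nonneg M.γ_nonneg t)
  have hm := integral_mono ((hg.integrable (pairLaw p π ν t)).add ((hK.integrable _).const_mul M.γ))
    ((hW.integrable _).add (integrable_const ε)) h
  simp only [Pi.add_apply] at hm
  rw [integral_add (hg.integrable _) ((hK.integrable _).const_mul M.γ), integral_const_mul,
    integral_add (hW.integrable _) (integrable_const _), ← integral_pairLaw_succ hW] at hm
  simp only [integral_const, probReal_univ, one_smul] at hm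
  linarith

/-- A bounded subsolution of the linear Bellman equation is dominated by the soft value. -/
lemma le_discountedValue (hb : BddMeasurable (M.bonus π)) {W : S × A → ℝ} (hW : BddMeasurable W)
    (h : ∀ x, W x ≤ M.meanReward x + M.bonus π x + M.γ * ∫ y, W y ∂pairKernel p π x)
    (ν : Measure (S × A)) [IsProbabilityMeasure ν] :
    ∫ x, W x ∂ν ≤ M.discountedValue p π ν := by
  have hg := (bddMeasurable_meanReward (M := M)).add hb
  have hK := hW.integral_kernel (pairKernel p π)
  obtain ⟨C, hC⟩ := hW.2
  have hle := (summable_discountedValue (p := p) hb ν).hasSum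
  have htel := hasSum_discounted_telescope M.γ_nonneg M.γ_lt_one
    fun t => abs_integral_le_of_abs_le hC (pairLaw p π ν t)
  refine hasSum_le (fun t => ?_) htel hle
  refine mul_le_mul_of_nonneg_left ?_ (pow_nonneg M.γ_nonneg t)
  have hm := integral_mono (hW.integrable _)
    ((hg.integrable (pairLaw p π ν t)).add ((hK.integrable _).const_mul M.γ)) h
  simp only [Pi.add_apply] at hm
  rw [integral_add (hg.integrable _) ((hK.integrable _).const_mul M.γ), integral_const_mul,
    ← integral_pairLaw_succ hW] at hm
  linarith

end RobustMDP

/-! ### Discounted operators -/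

/-- A discounted dynamic programming operator: it preserves bounded measurable functions, is
monotone, and shrinks one-sided constant perturbations by the factor `γ`. -/
structure IsDiscounted {X : Type*} [MeasurableSpace X] (T : (X → ℝ) → X → ℝ) (γ : ℝ) : Prop where
  bddMeasurable : ∀ ⦃f⦄, BddMeasurable f → BddMeasurable (T f)
  le_add : ∀ ⦃f g⦄, BddMeasurable f → BddMeasurable g → ∀ ⦃c : ℝ⦄, (∀ x, f x ≤ g x + c) →
    ∀ x, T f x ≤ T g x + γ * c

namespace IsDiscounted

variable {X : Type*} [MeasurableSpace X] {T : (X → ℝ) → X → ℝ} {γ : ℝ} {f g Q : X → ℝ}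

lemma mono (hT : IsDiscounted T γ) (hf : BddMeasurable f) (hg : BddMeasurable g)
    (h : ∀ x, f x ≤ g x) (x : X) : T f x ≤ T g x := by
  simpa using hT.le_add hf hg (c := 0) (by simpa using h) x

lemma abs_sub_le (hT : IsDiscounted T γ) (hf : BddMeasurable f) (hg : BddMeasurable g) {c : ℝ}
    (h : ∀ x, |f x - g x| ≤ c) (x : X) : |T f x - T g x| ≤ γ * c := by
  have h1 := hT.le_add hf hg (c := c) (fun x => by linarith [(abs_le.1 (h x)).2]) x
  have h2 := hT.le_add hg hf (c := c) (fun x => by linarith [(abs_le.1 (h x)).1]) x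
  exact abs_le.2 ⟨by linarith, by linarith⟩

lemma bddMeasurable_iterate (hT : IsDiscounted T γ) (hf : BddMeasurable f) (n : ℕ) :
    BddMeasurable (T^[n] f) := by
  induction n with
  | zero => exact hf
  | succ n ih => rw [Function.iterate_succ_apply']; exact hT.bddMeasurable ih

lemma abs_iterate_sub_le (hT : IsDiscounted T γ) (hf : BddMeasurable f) (hg : BddMeasurable g)
    {c : ℝ} (h : ∀ x, |f x - g x| ≤ c) (n : ℕ) (x : X) :
    |T^[n] f x - T^[n] g x| ≤ γ ^ n * c := by
  induction n generalizing x with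
  | zero => simpa using h x
  | succ n ih =>
    rw [Function.iterate_succ_apply', Function.iterate_succ_apply', pow_succ', mul_assoc]
    exact hT.abs_sub_le (hT.bddMeasurable_iterate hf n) (hT.bddMeasurable_iterate hg n) ih x

lemma tendsto_iterate (hT : IsDiscounted T γ) (h0 : 0 ≤ γ) (h1 : γ < 1) (hQ : BddMeasurable Q)
    (hfix : T Q = Q) (hf : BddMeasurable f) (x : X) :
    Tendsto (fun n => T^[n] f x) atTop (𝓝 (Q x)) := by
  obtain ⟨C, hC⟩ := hQ.2
  obtain ⟨C', hC'⟩ := hf.2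
  rw [tendsto_iff_norm_sub_tendsto_zero]
  refine squeeze_zero (fun _ => norm_nonneg _) (fun n => ?_)
    (by simpa using (tendsto_pow_atTop_nhds_zero_of_lt_one h0 h1).mul_const (C' + C))
  have h := hT.abs_iterate_sub_le hf hQ
    (fun x => (abs_sub _ _).trans (add_le_add (hC' x) (hC x))) n x
  rwa [Function.iterate_fixed hfix] at h

theorem exists_fixedPoint (hT : IsDiscounted T γ) (h0 : 0 ≤ γ) (h1 : γ < 1) :
    ∃ Q, BddMeasurable Q ∧ T Q = Q := by
  have hz : BddMeasurable fun _ : X => (0 : ℝ) := ⟨measurable_const, 0, by simp⟩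
  set u : ℕ → X → ℝ := fun n => T^[n] fun _ => 0 with hu
  have hub : ∀ n, BddMeasurable (u n) := hT.bddMeasurable_iterate hz
  obtain ⟨C, hC⟩ := (hT.bddMeasurable hz).2
  have hstep : ∀ x n, dist (u n x) (u (n + 1) x) ≤ C * γ ^ n := fun x n => by
    have h := hT.abs_iterate_sub_le (hT.bddMeasurable hz) hz (c := C) (by simpa using hC) n x
    rw [dist_comm, Real.dist_eq, mul_comm]
    simpa only [hu, Function.iterate_succ_apply] using h
  choose Q hQ using fun x => cauchySeq_tendsto_of_complete
    (cauchySeq_of_le_geometric γ C h1 (hstep x))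
  have hdist : ∀ n x, |u n x - Q x| ≤ C * γ ^ n / (1 - γ) := fun n x => by
    rw [← Real.dist_eq]
    exact dist_le_of_le_geometric_of_tendsto γ C h1 (hstep x) (hQ x) n
  have hQb : BddMeasurable Q := by
    refine ⟨measurable_of_tendsto_metrizable (fun n => (hub n).1) (tendsto_pi_nhds.2 hQ),
      C / (1 - γ), fun x => ?_⟩
    simpa [hu] using hdist 0 x
  refine ⟨Q, hQb, funext fun x => ?_⟩
  have hlim : Tendsto (fun n => u (n + 1) x) atTop (𝓝 (T Q x)) := by
    rw [tendsto_iff_norm_sub_tendsto_zero]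
    refine squeeze_zero (fun _ => norm_nonneg _)
      (fun n => ?_) (g := fun n => γ * (C * γ ^ n / (1 - γ))) ?_
    · have h := hT.abs_sub_le (hub n) hQb (hdist n) x
      simpa only [hu, Function.iterate_succ_apply', Real.norm_eq_abs] using h
    · simpa using (((tendsto_pow_atTop_nhds_zero_of_lt_one h0 h1).const_mul C).div_const
        (1 - γ)).const_mul γ
  exact tendsto_nhds_unique hlim ((tendsto_add_atTop_iff_nat 1).2 (hQ x))

/-- A subsolution lies below the fixed point. -/
theorem le_fixedPoint (hT : IsDiscounted T γ) (h0 : 0 ≤ γ) (h1 : γ < 1) (hQ : BddMeasurable Q)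
    (hfix : T Q = Q) (hf : BddMeasurable f) (h : ∀ x, f x ≤ T f x) (x : X) : f x ≤ Q x := by
  refine ge_of_tendsto' (hT.tendsto_iterate h0 h1 hQ hfix hf x) fun n => ?_
  have : ∀ n x, f x ≤ T^[n] f x := fun n => by
    induction n with
    | zero => exact fun _ => le_rfl
    | succ n ih =>
      intro x
      rw [Function.iterate_succ_apply']
      exact (h x).trans (hT.mono hf (hT.bddMeasurable_iterate hf n) ih x)
  exact this n x

end IsDiscounted

namespace RobustMDP

variable {S A : Type*} [MeasurableSpace S] [MeasurableSpace A] (M : RobustMDP S A)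

/-! ### Entropy-regularized means and soft maxima -/

/-- The entropy-regularized mean of `Q (s, ·)` under `π`, which is the soft value of `π` when `Q` is
its soft Q-function. -/
def policyMean (π : Policy S A) (Q : S × A → ℝ) (s : S) : ℝ :=
  ∫ a, (Q (s, a) - M.α * Real.log (π.prob s a)) ∂π.1 s

/-- The soft maximum `α log ∑ₐ exp (Q (s, a) / α)`. -/
def softMax [Fintype A] (Q : S × A → ℝ) (s : S) : ℝ :=
  M.α * Real.log (∑ a, Real.exp (Q (s, a) / M.α))

/-- The probabilities of the Boltzmann distribution, normalized through the soft maximum. -/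
def boltzmannProb [Fintype A] (Q : S × A → ℝ) (s : S) (a : A) : ℝ :=
  Real.exp ((Q (s, a) - M.softMax Q s) / M.α)

/-- The robust soft Bellman optimality operator. -/
def optBellman [Fintype A] (Q : S × A → ℝ) (x : S × A) : ℝ :=
  M.meanReward x + M.γ * M.worstMean (M.softMax Q) x

variable {M} {π : Policy S A} {Q Q' : S × A → ℝ}

lemma bellman_eq (x : S × A) :
    M.bellman π Q x = M.meanReward x + M.γ * M.worstMean (M.policyMean π Q) x := rfl

lemma prob_nonneg (s : S) (a : A) : 0 ≤ π.prob s a := measureReal_nonneg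

lemma prob_le_one (s : S) (a : A) : π.prob s a ≤ 1 := measureReal_le_one

lemma BddMeasurable.slice (hQ : BddMeasurable Q) (a : A) : BddMeasurable fun s => Q (s, a) :=
  ⟨hQ.1.comp measurable_prodMk_right, hQ.2.imp fun _ h s => h (s, a)⟩

lemma bddMeasurable_sum {ι : Type*} [Fintype ι] {f : ι → S → ℝ} (h : ∀ a, BddMeasurable (f a)) :
    BddMeasurable fun s => ∑ a, f a s := by
  choose hm C hC using h
  exact ⟨Finset.measurable_fun_sum _ fun a _ => hm a, ∑ a, C a, fun s =>
    (Finset.abs_sum_le_sum_abs _ _).trans (Finset.sum_le_sum fun a _ => hC a s)⟩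

lemma measurable_prob [MeasurableSingletonClass A] (a : A) : Measurable fun s => π.prob s a :=
  (Kernel.measurable_coe π.1 (measurableSet_singleton a)).ennreal_toReal

lemma abs_prob_mul_log_le (s : S) (a : A) : |π.prob s a * Real.log (π.prob s a)| ≤ 1 := by
  rcases (prob_nonneg (π := π) s a).eq_or_lt with h | h
  · simp [← h]
  · rw [mul_comm]
    exact (Real.abs_log_mul_self_lt _ h (prob_le_one s a)).le

lemma bddMeasurable_prob_mul_log [MeasurableSingletonClass A] (a : A) :
    BddMeasurable fun s => π.prob s a * Real.log (π.prob s a) :=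
  ⟨(measurable_prob a).mul (measurable_prob a).log, 1, fun s => abs_prob_mul_log_le s a⟩

lemma sum_exp_pos {ι : Type*} [Fintype ι] [Nonempty ι] (f : ι → ℝ) : 0 < ∑ i, Real.exp (f i) :=
  Finset.sum_pos (fun _ _ => Real.exp_pos _) Finset.univ_nonempty

section PolicyMean

variable [Fintype A] [MeasurableSingletonClass A]

lemma sum_prob (s : S) : ∑ a, π.prob s a = 1 := by simp [Policy.prob]

lemma policyMean_eq_sum (s : S) : M.policyMean π Q s =
    ∑ a, π.prob s a * (Q (s, a) - M.α * Real.log (π.prob s a)) := by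
  rw [policyMean, integral_fintype Integrable.of_finite]
  rfl

lemma bddMeasurable_policyMean (hQ : BddMeasurable Q) : BddMeasurable (M.policyMean π Q) := by
  have hp : ∀ a, BddMeasurable fun s => π.prob s a := fun a =>
    ⟨measurable_prob a, 1, fun s => by
      rw [abs_of_nonneg (prob_nonneg s a)]; exact prob_le_one s a⟩
  have h : M.policyMean π Q = fun s => ∑ a, (π.prob s a * Q (s, a) +
      -M.α * (π.prob s a * Real.log (π.prob s a))) := by
    funext s
    rw [policyMean_eq_sum]
    exact Finset.sum_congr rfl fun a _ => by ring
  rw [h]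
  exact bddMeasurable_sum fun a =>
    ((hp a).mul (BddMeasurable.slice hQ a)).add ((bddMeasurable_prob_mul_log a).const_mul _)

lemma bddMeasurable_bonus : BddMeasurable (M.bonus π) := by
  have h : M.bonus π = fun x => (M.policyMean π fun _ => 0) x.1 := by
    funext x
    simp only [bonus, Policy.entropy, policyMean, zero_sub]
    rw [← integral_const_mul]
    simp
  rw [h]
  have hb := bddMeasurable_policyMean (M := M) (π := π) (Q := fun _ => 0)
    ⟨measurable_const, 0, by simp⟩
  exact ⟨hb.1.comp measurable_fst, hb.2.imp fun _ h x => h x.1⟩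

/-- The soft value at a state is the mean, over the action drawn by `π`, of the soft Q-function with
the entropy bonus of the state added. -/
lemma integral_drawAction (hQ : BddMeasurable Q) (s : S) :
    ∫ x, (Q x + M.bonus π x) ∂drawAction π s = M.policyMean π Q s := by
  have h : drawAction π s = (π.1 s).map (Prod.mk s) := by
    rw [drawAction, Kernel.prod_apply, Kernel.id_apply, Measure.dirac_prod]
  rw [h, integral_map measurable_prodMk_left.aemeasurable
    (hQ.add bddMeasurable_bonus).1.aestronglyMeasurable]
  simp only [bonus, Policy.entropy, policyMean]
  rw [integral_add Integrable.of_finite Integrable.of_finite,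
    integral_sub Integrable.of_finite Integrable.of_finite, integral_neg, integral_const_mul]
  simp [integral_const_mul, sub_eq_add_neg]

lemma policyMean_le_add {c : ℝ} (h : ∀ x, Q x ≤ Q' x + c) (s : S) :
    M.policyMean π Q s ≤ M.policyMean π Q' s + c := by
  rw [policyMean_eq_sum, policyMean_eq_sum, ← mul_one c, ← sum_prob (π := π) s, Finset.mul_sum,
    ← Finset.sum_add_distrib]
  refine Finset.sum_le_sum fun a _ => ?_
  have := mul_le_mul_of_nonneg_left (h (s, a)) (prob_nonneg (π := π) s a)
  linarith

lemma isDiscounted_bellman : IsDiscounted (M.bellman π) M.γ where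
  bddMeasurable _ hf := bddMeasurable_meanReward.add
    ((bddMeasurable_worstMean (bddMeasurable_policyMean hf)).const_mul _)
  le_add f g hf hg c h x := by
    rw [bellman_eq, bellman_eq, add_assoc, ← mul_add]
    gcongr
    · exact M.γ_nonneg
    · exact worstMean_le_add (bddMeasurable_policyMean hf) (bddMeasurable_policyMean hg)
        (policyMean_le_add h) x

end PolicyMean

section SoftMax

variable [Fintype A] [Nonempty A]

lemma softMax_le_add {c : ℝ} (h : ∀ x, Q x ≤ Q' x + c) (s : S) :
    M.softMax Q s ≤ M.softMax Q' s + c := by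
  have hα := M.α_pos
  have hle : ∑ a, Real.exp (Q (s, a) / M.α) ≤
      Real.exp (c / M.α) * ∑ a, Real.exp (Q' (s, a) / M.α) := by
    rw [Finset.mul_sum]
    refine Finset.sum_le_sum fun a _ => ?_
    rw [← Real.exp_add, Real.exp_le_exp, ← add_div]
    exact div_le_div_of_nonneg_right (by linarith [h (s, a)]) hα.le
  have hlog := Real.log_le_log (sum_exp_pos _) hle
  rw [Real.log_mul (Real.exp_pos _).ne' (sum_exp_pos _).ne', Real.log_exp] at hlog
  have := mul_le_mul_of_nonneg_left hlog hα.le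
  rw [mul_add, mul_div_cancel₀ _ hα.ne'] at this
  simp only [softMax]
  linarith

lemma abs_softMax_sub_le {c : ℝ} (h : ∀ x, |Q x - Q' x| ≤ c) (s : S) :
    |M.softMax Q s - M.softMax Q' s| ≤ c := by
  have h1 := softMax_le_add (M := M) (Q := Q) (Q' := Q') (c := c)
    (fun x => by linarith [(abs_le.1 (h x)).2]) s
  have h2 := softMax_le_add (M := M) (Q := Q') (Q' := Q) (c := c)
    (fun x => by linarith [(abs_le.1 (h x)).1]) s
  exact abs_le.2 ⟨by linarith, by linarith⟩

lemma bddMeasurable_softMax (hQ : BddMeasurable Q) : BddMeasurable (M.softMax Q) := by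
  refine ⟨((Finset.measurable_fun_sum _ fun a _ =>
    ((BddMeasurable.slice hQ a).1.div_const _).exp).log).const_mul _, ?_⟩
  obtain ⟨C, hC⟩ := hQ.2
  refine ⟨C + |M.α * Real.log (Fintype.card A)|, fun s => ?_⟩
  have h := abs_softMax_sub_le (M := M) (Q := Q) (Q' := fun _ => 0) (by simpa using hC) s
  have h0 : M.softMax (fun _ : S × A => 0) s = M.α * Real.log (Fintype.card A) := by
    simp [softMax]
  rw [h0] at h
  have := abs_add_le (M.softMax Q s - M.α * Real.log (Fintype.card A))
    (M.α * Real.log (Fintype.card A))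
  rw [sub_add_cancel] at this
  linarith

lemma isDiscounted_optBellman : IsDiscounted (M.optBellman) M.γ where
  bddMeasurable _ hf := bddMeasurable_meanReward.add
    ((bddMeasurable_worstMean (bddMeasurable_softMax hf)).const_mul _)
  le_add f g hf hg c h x := by
    rw [optBellman, optBellman, add_assoc, ← mul_add]
    gcongr
    · exact M.γ_nonneg
    · exact worstMean_le_add (bddMeasurable_softMax hf) (bddMeasurable_softMax hg)
        (softMax_le_add h) x

end SoftMax

end RobustMDP

namespace RobustMDP
variable {S A : Type*} [MeasurableSpace S] [MeasurableSpace A] {M : RobustMDP S A}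
  {π : Policy S A} {Q Q' : S × A → ℝ}

lemma policy_ext [Countable A] {π π' : Policy S A} (h : ∀ s a, π.prob s a = π'.prob s a) :
    π = π' := by
  refine Subtype.ext (Kernel.ext fun s => Measure.ext_of_singleton fun a => ?_)
  exact (measureReal_eq_measureReal_iff).1 (h s a)

/-! ### Robust values as fixed points -/

section Evaluation

variable [Fintype A] [MeasurableSingletonClass A]

lemma integral_pairKernel (hQ : BddMeasurable Q) (p : TransitionModel S A) (x : S × A) :
    ∫ y, (Q y + M.bonus π y) ∂pairKernel p π x = ∫ s, M.policyMean π Q s ∂p.1 x := by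
  rw [pairKernel, Kernel.integral_comp ((hQ.add bddMeasurable_bonus).integrable _)]
  exact integral_congr_ae (ae_of_all _ fun s => integral_drawAction hQ s)

/-- The fixed point of the robust Bellman operator, with the bonus added, is a subsolution of the
linear Bellman equation of every model in the ambiguity set. -/
lemma le_discountedValue_of_fixedPoint (hQ : BddMeasurable Q) (hfix : M.bellman π Q = Q)
    {p : TransitionModel S A} (hp : p ∈ M.ambiguitySet)
    (ν : Measure (S × A)) [IsProbabilityMeasure ν] :
    ∫ x, (Q x + M.bonus π x) ∂ν ≤ M.discountedValue p π ν := by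
  refine le_discountedValue bddMeasurable_bonus (hQ.add bddMeasurable_bonus) (fun x => ?_) ν
  rw [integral_pairKernel hQ]
  have h := worstMean_le (bddMeasurable_policyMean (M := M) (π := π) hQ) x (p.1 x) (hp x)
  have h1 := mul_le_mul_of_nonneg_left h M.γ_nonneg
  have h2 := congrFun hfix x
  rw [bellman_eq] at h2
  linarith

/-- The fixed point of the robust Bellman operator is nearly attained by a single model in the
ambiguity set, uniformly in the initial law. -/
lemma exists_discountedValue_le (hQ : BddMeasurable Q) (hfix : M.bellman π Q = Q)
    {ε : ℝ} (hε : 0 < ε) :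
    ∃ p ∈ M.ambiguitySet, ∀ (ν : Measure (S × A)) [IsProbabilityMeasure ν],
      M.discountedValue p π ν ≤ ∫ x, (Q x + M.bonus π x) ∂ν + ε := by
  have h1γ : 0 < 1 - M.γ := sub_pos.2 M.γ_lt_one
  obtain ⟨p, hp, hle⟩ := exists_ambiguitySet_le_worstMean (M := M)
    (bddMeasurable_policyMean (M := M) (π := π) hQ) (mul_pos hε h1γ)
  -- Errors `ε (1 - γ)` per step accumulate to `ε`.
  refine ⟨p, hp, fun ν _ => ?_⟩
  rw [← mul_div_cancel_right₀ ε h1γ.ne']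
  refine discountedValue_le bddMeasurable_bonus (hQ.add bddMeasurable_bonus) (fun x => ?_) ν
  rw [integral_pairKernel hQ]
  have h1 := mul_le_mul_of_nonneg_left (hle x) M.γ_nonneg
  have h2 := congrFun hfix x
  have h3 : M.γ * (ε * (1 - M.γ)) ≤ ε * (1 - M.γ) :=
    mul_le_of_le_one_left (mul_pos hε h1γ).le M.γ_lt_one.le
  rw [bellman_eq] at h2
  linarith

/-- The worst-case value over stationary models, read off the robust Bellman fixed point. The
constant `b` is the bonus of the initial state for the Q-function, and `0` for the value function. -/
lemma iInf_discountedValue (hQ : BddMeasurable Q) (hfix : M.bellman π Q = Q)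
    (ν : Measure (S × A)) [IsProbabilityMeasure ν] (b : ℝ) :
    ⨅ p : M.ambiguitySet, (M.discountedValue p.1 π ν - b) =
      ∫ x, (Q x + M.bonus π x) ∂ν - b := by
  have hlow : ∀ p : M.ambiguitySet,
      ∫ x, (Q x + M.bonus π x) ∂ν - b ≤ M.discountedValue p.1 π ν - b := fun p =>
    sub_le_sub_right (le_discountedValue_of_fixedPoint hQ hfix p.2 ν) b
  have : Nonempty M.ambiguitySet :=
    ⟨⟨(exists_discountedValue_le hQ hfix one_pos).choose,
      (exists_discountedValue_le hQ hfix one_pos).choose_spec.1⟩⟩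
  refine le_antisymm (le_of_forall_pos_le_add fun ε hε => ?_) (le_ciInf hlow)
  obtain ⟨p, hp, hle⟩ := exists_discountedValue_le hQ hfix hε
  refine (ciInf_le ⟨_, Set.forall_mem_range.2 hlow⟩ ⟨p, hp⟩).trans ?_
  linarith [hle ν]

theorem robustQ_eq_of_fixedPoint (hQ : BddMeasurable Q) (hfix : M.bellman π Q = Q) :
    M.robustQ π = Q := by
  funext x
  simp only [robustQ, modelQ_eq bddMeasurable_bonus]
  rw [iInf_discountedValue hQ hfix, integral_dirac' _ _
    (hQ.add bddMeasurable_bonus).1.stronglyMeasurable, add_sub_cancel_right]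

theorem robustV_eq_of_fixedPoint (hQ : BddMeasurable Q) (hfix : M.bellman π Q = Q) (s : S) :
    M.robustV π s = M.policyMean π Q s := by
  simp only [robustV, modelV_eq bddMeasurable_bonus]
  have h := iInf_discountedValue hQ hfix (drawAction π s) 0
  simpa only [sub_zero, integral_drawAction hQ] using h

end Evaluation

section RobustQ

variable [Fintype A] [MeasurableSingletonClass A]

lemma bddMeasurable_robustQ_and_bellman :
    BddMeasurable (M.robustQ π) ∧ M.bellman π (M.robustQ π) = M.robustQ π := by
  obtain ⟨Q, hQ, hfix⟩ := (isDiscounted_bellman (M := M) (π := π)).exists_fixedPoint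
    M.γ_nonneg M.γ_lt_one
  rw [robustQ_eq_of_fixedPoint hQ hfix]
  exact ⟨hQ, hfix⟩

lemma bddMeasurable_robustQ : BddMeasurable (M.robustQ π) := bddMeasurable_robustQ_and_bellman.1

lemma bellman_robustQ : M.bellman π (M.robustQ π) = M.robustQ π :=
  bddMeasurable_robustQ_and_bellman.2

lemma robustV_eq (s : S) : M.robustV π s = M.policyMean π (M.robustQ π) s :=
  robustV_eq_of_fixedPoint bddMeasurable_robustQ bellman_robustQ s

lemma isEvaluation_robustQ (hQ : BddMeasurable Q) : M.IsEvaluation π Q (M.robustQ π) :=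
  isDiscounted_bellman.tendsto_iterate M.γ_nonneg M.γ_lt_one bddMeasurable_robustQ
    bellman_robustQ hQ

end RobustQ

/-! ### The Boltzmann policy and policy improvement -/

section Boltzmann

variable [Fintype A]

lemma boltzmannProb_pos (s : S) (a : A) : 0 < M.boltzmannProb Q s a := Real.exp_pos _

lemma log_boltzmannProb (s : S) (a : A) :
    M.α * Real.log (M.boltzmannProb Q s a) = Q (s, a) - M.softMax Q s := by
  rw [boltzmannProb, Real.log_exp, mul_div_cancel₀ _ M.α_pos.ne']

/-- The gap between the soft maximum and the entropy-regularized mean is `α` times the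
Kullback-Leibler divergence to the Boltzmann distribution. -/
lemma softMax_sub_policyMean [MeasurableSingletonClass A] (s : S) :
    M.softMax Q s - M.policyMean π Q s =
      M.α * ∑ a, π.prob s a * (Real.log (π.prob s a) - Real.log (M.boltzmannProb Q s a)) := by
  have h : M.softMax Q s = ∑ a, π.prob s a * M.softMax Q s := by
    rw [← Finset.sum_mul, sum_prob, one_mul]
  rw [policyMean_eq_sum, h, ← Finset.sum_sub_distrib, Finset.mul_sum]
  refine Finset.sum_congr rfl fun a _ => ?_
  have := log_boltzmannProb (M := M) (Q := Q) s a
  linear_combination π.prob s a * this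

variable [Nonempty A]

lemma boltzmannProb_eq (s : S) (a : A) : M.boltzmannProb Q s a =
    Real.exp (Q (s, a) / M.α) / ∑ b, Real.exp (Q (s, b) / M.α) := by
  rw [boltzmannProb, sub_div, Real.exp_sub, softMax, mul_div_cancel_left₀ _ M.α_pos.ne',
    Real.exp_log (sum_exp_pos _)]

lemma sum_boltzmannProb (s : S) : ∑ a, M.boltzmannProb Q s a = 1 := by
  simp only [boltzmannProb_eq, ← Finset.sum_div]
  exact div_self (sum_exp_pos _).ne'

lemma boltzmannProb_le_one (s : S) (a : A) : M.boltzmannProb Q s a ≤ 1 := by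
  rw [← sum_boltzmannProb (M := M) (Q := Q) s]
  exact Finset.single_le_sum (fun b _ => (boltzmannProb_pos s b).le) (Finset.mem_univ a)

/-- The Boltzmann distribution depends on `Q` in a Lipschitz way, uniformly in the state: both
exponents are nonpositive, where `exp` is `1`-Lipschitz. -/
lemma abs_boltzmannProb_sub_le {c : ℝ} (h : ∀ x, |Q x - Q' x| ≤ c) (s : S) (a : A) :
    |M.boltzmannProb Q s a - M.boltzmannProb Q' s a| ≤ 2 * c / M.α := by
  have hexp : ∀ u v : ℝ, Real.exp u ≤ 1 → Real.exp u - Real.exp v ≤ |u - v| := fun u v hu => by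
    have h1 := Real.add_one_le_exp (v - u)
    have h2 : Real.exp v = Real.exp u * Real.exp (v - u) := by rw [← Real.exp_add]; ring_nf
    have h3 := le_abs_self (u - v)
    have h4 := abs_nonneg (u - v)
    have h5 := Real.exp_pos u
    rw [h2]
    nlinarith
  have hdiff : |(Q (s, a) - M.softMax Q s) / M.α - (Q' (s, a) - M.softMax Q' s) / M.α| ≤
      2 * c / M.α := by
    rw [← sub_div, abs_div, abs_of_pos M.α_pos]
    refine div_le_div_of_nonneg_right ?_ M.α_pos.le
    have h1 := abs_le.1 (h (s, a))
    have h2 := abs_le.1 (abs_softMax_sub_le (M := M) h s)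
    exact abs_le.2 ⟨by linarith, by linarith⟩
  have h1 := hexp _ ((Q' (s, a) - M.softMax Q' s) / M.α)
    (boltzmannProb_le_one (M := M) (Q := Q) s a)
  have h2 := hexp _ ((Q (s, a) - M.softMax Q s) / M.α)
    (boltzmannProb_le_one (M := M) (Q := Q') s a)
  rw [abs_sub_comm] at h2
  have h1' := h1.trans hdiff
  have h2' := h2.trans hdiff
  exact abs_le.2 ⟨by simp only [boltzmannProb]; linarith, h1'⟩

variable [MeasurableSingletonClass A]

lemma boltzmann_singleton (s : S) (a : A) :
    M.boltzmann Q s {a} = ENNReal.ofReal (M.boltzmannProb Q s a) := by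
  rw [boltzmann, tilted_apply' _ _ (measurableSet_singleton a), Measure.restrict_singleton]
  simp [boltzmannProb_eq, integral_count]

/-- The Boltzmann distributions of `Q`, as a policy. -/
def boltzmannPolicy (M : RobustMDP S A) (hQ : Measurable Q) : Policy S A :=
  ⟨{ toFun := M.boltzmann Q
     measurable' := by
      refine Measure.measurable_of_measurable_coe _ fun B hB => ?_
      have h : ∀ s, M.boltzmann Q s B =
          ∑ a ∈ B.toFinite.toFinset, ENNReal.ofReal (M.boltzmannProb Q s a) := fun s => by
        simp only [← boltzmann_singleton]
        rw [sum_measure_singleton]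
        simp
      simp_rw [h, boltzmannProb_eq]
      refine Finset.measurable_fun_sum _ fun a _ => Measurable.ennreal_ofReal ?_
      exact ((hQ.comp measurable_prodMk_right).div_const _).exp.div
        (Finset.measurable_fun_sum _ fun b _ =>
          ((hQ.comp measurable_prodMk_right).div_const _).exp) },
   ⟨fun _ => isProbabilityMeasure_tilted Integrable.of_finite⟩⟩

lemma boltzmannPolicy_prob (hQ : Measurable Q) (s : S) (a : A) :
    (M.boltzmannPolicy hQ).prob s a = M.boltzmannProb Q s a := by
  change (M.boltzmann Q s {a}).toReal = _
  rw [boltzmann_singleton, ENNReal.toReal_ofReal (boltzmannProb_pos s a).le]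

lemma isImprovement_iff (hQ : Measurable Q) :
    M.IsImprovement Q π ↔ π = M.boltzmannPolicy hQ := by
  have hself : ∀ s, klDiv ((M.boltzmannPolicy hQ).1 s) (M.boltzmann Q s) = 0 := fun s =>
    klDiv_self ((M.boltzmannPolicy hQ).1 s)
  constructor
  · intro h
    refine Subtype.ext (Kernel.ext fun s => ?_)
    have h0 := (h s (M.boltzmannPolicy hQ)).trans_eq (hself s)
    exact (klDiv_eq_zero_iff (ν := (M.boltzmannPolicy hQ).1 s)).1 (le_antisymm h0 zero_le)
  · rintro rfl s π'
    rw [hself]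
    exact zero_le

/-- One term of the Gibbs inequality, with its equality case. -/
lemma sub_le_mul_log_sub_log {u v : ℝ} (hu : 0 ≤ u) (hv : 0 < v) :
    u - v ≤ u * (Real.log u - Real.log v) ∧
      (u * (Real.log u - Real.log v) = u - v → u = v) := by
  rcases hu.eq_or_lt with rfl | hu
  · exact ⟨by simpa using hv.le, fun h => by linarith [show (0 : ℝ) = 0 - v by simpa using h]⟩
  have hlog : u * (Real.log u - Real.log v) = -(u * Real.log (v / u)) := by
    rw [Real.log_div hv.ne' hu.ne']; ring
  have hmul : u * (v / u - 1) = v - u := by field_simp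
  constructor
  · have h := mul_le_mul_of_nonneg_left (Real.log_le_sub_one_of_pos (div_pos hv hu)) hu.le
    linarith
  · intro h
    by_contra hne
    have h1 := mul_lt_mul_of_pos_left (Real.log_lt_sub_one_of_pos (div_pos hv hu)
      (fun h => hne ((div_eq_one_iff_eq hu.ne').1 h).symm)) hu
    linarith

lemma policyMean_le_softMax (s : S) : M.policyMean π Q s ≤ M.softMax Q s := by
  rw [← sub_nonneg, softMax_sub_policyMean]
  refine mul_nonneg M.α_pos.le ?_
  have h := Finset.sum_le_sum fun a (_ : a ∈ Finset.univ) =>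
    (sub_le_mul_log_sub_log (prob_nonneg (π := π) s a) (boltzmannProb_pos (M := M) (Q := Q) s a)).1
  rwa [Finset.sum_sub_distrib, sum_prob, sum_boltzmannProb, sub_self] at h

lemma prob_eq_of_policyMean_eq (s : S) (h : M.policyMean π Q s = M.softMax Q s) (a : A) :
    π.prob s a = M.boltzmannProb Q s a := by
  have hgap := softMax_sub_policyMean (M := M) (π := π) (Q := Q) s
  rw [h, sub_self, eq_comm, mul_eq_zero, or_iff_right M.α_pos.ne'] at hgap
  have hterm := fun a => sub_le_mul_log_sub_log (prob_nonneg (π := π) s a)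
    (boltzmannProb_pos (M := M) (Q := Q) s a)
  have hsum : ∑ a, (π.prob s a - M.boltzmannProb Q s a) =
      ∑ a, π.prob s a * (Real.log (π.prob s a) - Real.log (M.boltzmannProb Q s a)) := by
    rw [hgap, Finset.sum_sub_distrib, sum_prob, sum_boltzmannProb, sub_self]
  exact (hterm a).2
    (((Finset.sum_eq_sum_iff_of_le fun a _ => (hterm a).1).1 hsum a (Finset.mem_univ a)).symm)

lemma policyMean_boltzmannPolicy (hQ : Measurable Q) :
    M.policyMean (M.boltzmannPolicy hQ) Q = M.softMax Q := by
  funext s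
  have h := softMax_sub_policyMean (M := M) (π := M.boltzmannPolicy hQ) (Q := Q) s
  simp only [boltzmannPolicy_prob, sub_self, mul_zero, Finset.sum_const_zero] at h
  linarith

lemma bellman_boltzmannPolicy (hQ : Measurable Q) :
    M.bellman (M.boltzmannPolicy hQ) Q = M.optBellman Q := by
  funext x
  rw [bellman_eq, policyMean_boltzmannPolicy, optBellman]

lemma bellman_le_optBellman (hQ : BddMeasurable Q) (x : S × A) :
    M.bellman π Q x ≤ M.optBellman Q x := by
  rw [bellman_eq, optBellman]
  have := mul_le_mul_of_nonneg_left (worstMean_mono (M := M)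
    (bddMeasurable_policyMean (M := M) (π := π) hQ) (bddMeasurable_softMax hQ) policyMean_le_softMax x)
    M.γ_nonneg
  linarith

end Boltzmann

/-! ### Optimality and convergence -/

section Optimality

variable [Fintype A] [Nonempty A] [MeasurableSingletonClass A] {Qs : S × A → ℝ}

lemma robustQ_le (hQs : BddMeasurable Qs) (hfix : M.optBellman Qs = Qs) (x : S × A) :
    M.robustQ π x ≤ Qs x := by
  refine isDiscounted_optBellman.le_fixedPoint M.γ_nonneg M.γ_lt_one hQs hfix
    bddMeasurable_robustQ (fun x => ?_) x
  conv_lhs => rw [← bellman_robustQ]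
  exact bellman_le_optBellman bddMeasurable_robustQ x

lemma robustQ_boltzmannPolicy (hQs : BddMeasurable Qs) (hfix : M.optBellman Qs = Qs) :
    M.robustQ (M.boltzmannPolicy hQs.1) = Qs :=
  robustQ_eq_of_fixedPoint hQs ((bellman_boltzmannPolicy hQs.1).trans hfix)

lemma robustV_boltzmannPolicy (hQs : BddMeasurable Qs) (hfix : M.optBellman Qs = Qs) :
    M.robustV (M.boltzmannPolicy hQs.1) = M.softMax Qs := by
  funext s
  rw [robustV_eq, robustQ_boltzmannPolicy hQs hfix, policyMean_boltzmannPolicy]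

lemma isOptimal_boltzmannPolicy (hQs : BddMeasurable Qs) (hfix : M.optBellman Qs = Qs) :
    M.IsOptimal (M.boltzmannPolicy hQs.1) := fun π' s => by
  rw [robustV_boltzmannPolicy hQs hfix, robustV_eq]
  refine (policyMean_le_add (Q' := Qs) (c := 0) ?_ s).trans ?_
  · simpa using robustQ_le hQs hfix
  · simpa using policyMean_le_softMax s

/-- An optimal policy attains the soft maximum of the optimal Q-function at every state, which only
the Boltzmann policy does. -/
lemma eq_boltzmannPolicy_of_isOptimal (hQs : BddMeasurable Qs) (hfix : M.optBellman Qs = Qs)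
    (h : M.IsOptimal π) : π = M.boltzmannPolicy hQs.1 := by
  have hV : ∀ s, M.policyMean π (M.robustQ π) s = M.softMax Qs s := fun s => by
    rw [← robustV_eq, ← robustV_boltzmannPolicy hQs hfix]
    exact le_antisymm (isOptimal_boltzmannPolicy hQs hfix π s) (h _ s)
  have hQ : M.robustQ π = Qs := by
    rw [← bellman_robustQ, ← hfix]
    funext x
    rw [bellman_eq, optBellman, funext hV]
  refine policy_ext fun s a => ?_
  rw [boltzmannPolicy_prob]
  refine prob_eq_of_policyMean_eq s ?_ a
  rw [← hV s, hQ]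

/-- Policy improvement: one greedy step is at least as good as one step of value iteration. -/
lemma optBellman_le_robustQ_boltzmannPolicy (hQ : Measurable (M.robustQ π)) (x : S × A) :
    M.optBellman (M.robustQ π) x ≤ M.robustQ (M.boltzmannPolicy hQ) x := by
  have hb := bddMeasurable_robustQ (M := M) (π := π)
  have hle : ∀ x, M.robustQ π x ≤ M.bellman (M.boltzmannPolicy hQ) (M.robustQ π) x := fun x => by
    rw [bellman_boltzmannPolicy]
    conv_lhs => rw [← bellman_robustQ]
    exact bellman_le_optBellman hb x
  rw [← bellman_boltzmannPolicy hQ, ← bellman_robustQ (π := M.boltzmannPolicy hQ)]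
  refine isDiscounted_bellman.mono hb bddMeasurable_robustQ ?_ x
  exact isDiscounted_bellman.le_fixedPoint M.γ_nonneg M.γ_lt_one bddMeasurable_robustQ
    bellman_robustQ hb hle

/-- Along greedy steps the soft Q-functions converge geometrically to the optimal one. -/
lemma abs_robustQ_sub_le (hQs : BddMeasurable Qs) (hfix : M.optBellman Qs = Qs)
    {π : ℕ → Policy S A}
    (h : ∀ k, M.IsImprovement (M.robustQ (π k)) (π (k + 1))) :
    ∃ C, ∀ k x, |M.robustQ (π k) x - Qs x| ≤ M.γ ^ k * C := by
  obtain ⟨C, hC⟩ := hQs.2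
  obtain ⟨C', hC'⟩ := (bddMeasurable_robustQ (M := M) (π := π 0)).2
  refine ⟨C' + C, fun k => ?_⟩
  induction k with
  | zero =>
    intro x
    simpa using (abs_sub _ _).trans (add_le_add (hC' x) (hC x))
  | succ k ih =>
    intro x
    have hb := bddMeasurable_robustQ (M := M) (π := π k)
    have h1 := optBellman_le_robustQ_boltzmannPolicy hb.1 x
    rw [← (isImprovement_iff hb.1).1 (h k)] at h1
    have h2 := robustQ_le (π := π (k + 1)) hQs hfix x
    have h3 := abs_le.1 ((isDiscounted_optBellman (M := M)).abs_sub_le hb hQs ih x)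
    rw [hfix] at h3
    rw [pow_succ', mul_assoc]
    exact abs_le.2 ⟨by linarith, by linarith⟩

end Optimality

end RobustMDP

end DRSoft

end

theorem theorem1 {S A : Type*} [MeasurableSpace S] [MeasurableSpace A]
    [Finite A] [Nonempty A] [MeasurableSingletonClass A] (M : DRSoft.RobustMDP S A) :
    ∃ πstar : DRSoft.Policy S A,
      M.IsOptimal πstar ∧ (∀ π' : DRSoft.Policy S A, M.IsOptimal π' → π' = πstar) ∧
      ∀ (π₀ : DRSoft.Policy S A) (Q₀ : ℕ → S × A → ℝ),
        (∀ k, Measurable (Q₀ k)) → (∀ k, ∃ C : ℝ, ∀ x, |Q₀ k x| ≤ C) →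
        (∃ (π : ℕ → DRSoft.Policy S A) (Q : ℕ → S × A → ℝ), M.IsPolicyIteration π₀ Q₀ π Q) ∧
        ∀ (π : ℕ → DRSoft.Policy S A) (Q : ℕ → S × A → ℝ), M.IsPolicyIteration π₀ Q₀ π Q →
          (∀ k, Q k = M.robustQ (π k)) ∧
          TendstoUniformly (fun (k : ℕ) (x : S × A) => (π k).prob x.1 x.2)
            (fun x : S × A => πstar.prob x.1 x.2) atTop := by
  have := Fintype.ofFinite A
  obtain ⟨Qs, hQs, hfix⟩ := (DRSoft.RobustMDP.isDiscounted_optBellman (M := M)).exists_fixedPoint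
    M.γ_nonneg M.γ_lt_one
  refine ⟨M.boltzmannPolicy hQs.1, DRSoft.RobustMDP.isOptimal_boltzmannPolicy hQs hfix,
    fun _ => DRSoft.RobustMDP.eq_boltzmannPolicy_of_isOptimal hQs hfix,
    fun π₀ Q₀ hm hb => ⟨?_, fun π Q h => ?_⟩⟩
  · let π : ℕ → DRSoft.Policy S A := fun k =>
      k.rec π₀ fun _ π => M.boltzmannPolicy
        (DRSoft.RobustMDP.bddMeasurable_robustQ (M := M) (π := π)).1
    exact ⟨π, fun k => M.robustQ (π k), rfl,
      fun k => DRSoft.RobustMDP.isEvaluation_robustQ ⟨hm k, hb k⟩,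
      fun k => (DRSoft.RobustMDP.isImprovement_iff
        (DRSoft.RobustMDP.bddMeasurable_robustQ (π := π k)).1).2 rfl⟩
  · have hQ : ∀ k, Q k = M.robustQ (π k) := fun k => funext fun x =>
      tendsto_nhds_unique (h.evaluation k x)
        (DRSoft.RobustMDP.isEvaluation_robustQ ⟨hm k, hb k⟩ x)
    have himp : ∀ k, M.IsImprovement (M.robustQ (π k)) (π (k + 1)) := fun k =>
      hQ k ▸ h.improvement k
    refine ⟨hQ, ?_⟩
    obtain ⟨C, hC⟩ := DRSoft.RobustMDP.abs_robustQ_sub_le hQs hfix himp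
    have hbound : ∀ k (x : S × A), |(π (k + 1)).prob x.1 x.2 -
        (M.boltzmannPolicy hQs.1).prob x.1 x.2| ≤ 2 * (M.γ ^ k * C) / M.α := fun k x => by
      rw [(DRSoft.RobustMDP.isImprovement_iff DRSoft.RobustMDP.bddMeasurable_robustQ.1).1 (himp k),
        DRSoft.RobustMDP.boltzmannPolicy_prob, DRSoft.RobustMDP.boltzmannPolicy_prob]
      exact DRSoft.RobustMDP.abs_boltzmannProb_sub_le (hC k) x.1 x.2
    have hlim : Tendsto (fun k : ℕ => 2 * (M.γ ^ k * C) / M.α) atTop (𝓝 0) := by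
      simpa using (((tendsto_pow_atTop_nhds_zero_of_lt_one M.γ_nonneg M.γ_lt_one).mul_const
        C).const_mul 2).div_const M.α
    rw [Metric.tendstoUniformly_iff]
    intro ε hε
    -- The bound at time `k + 1` comes from the evaluation at time `k`.
    obtain ⟨N, hN⟩ := eventually_atTop.1 (hlim.eventually_lt_const hε)
    refine eventually_atTop.2 ⟨N + 1, fun k hk x => ?_⟩
    obtain ⟨k, rfl⟩ := Nat.exists_eq_succ_of_ne_zero (Nat.ne_zero_of_lt hk)
    rw [dist_comm, Real.dist_eq]
    exact (hbound k x).trans_lt (hN k (Nat.le_of_succ_le_succ hk))
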